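/- Corollary 4.5. Let $\mathbb K=\mathbb R$ or $\mathbb C$, and let $(p_n)$ be a sequence in $[1,\infty)$ with $p_n\neq 2$ for all $n$ and $p_n\to 2$. For a normed space $X$ over $\mathbb K$ let $$a(X)=\tfrac12\sup\{\|x+y\|^2+\|x-y\|^2 : x,y\in X,\ \|x\|^2+\|y\|^2=1\}$$ be its Jordan–von Neumann constant (with $a(\{0\})=0$), and let $(E_n)$ be a sequence of finite-dimensional normed spaces over $\mathbb K$ with $a(E_n)\to 1$ (in particular $E_n\neq\{0\}$ for all large $n$). Let $E=(\bigoplus_n E_n)_N$ be the Nakano direct sum, that is, the space of all $x\in\prod_n E_n$ with $\Theta(x):=\sum_n\|x(n)\|_{E_n}^{p_n}<\infty$, normed by $\|x\|=\inf\{\lambda>0:\Theta(x/\lambda)\le 1\}$. For a Hilbert space $H$ over $\mathbb K$ let the modular direct sum $E\oplus_m H$ be the linear space $E\times H$ normed by $$\|(x,h)\|=\inf\{\lambda>0:\Theta(x/\lambda)+\|h/\lambda\|_H^2\le 1\}.$$ For an ultrafilter $\mathcal U$ on a set $I$, the ultrapower $X_{\mathcal U}$ of a normed space $X$ is the quotient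 of $\ell_\infty(I,X)$ by the subspace of families $(x_i)$ with $\lim_{\mathcal U}\|x_i\|=0$, with the quotient norm. The elementary class of a normed space $X$ is the class of all Banach spaces $Y$ such that $Y_{\mathcal U}$ and $X_{\mathcal V}$ are linearly isometric for some ultrafilters $\mathcal U,\mathcal V$ (on possibly different sets). Then: 1. The elementary class of $E$ is equal to the class of all Banach spaces that are linearly isometric to $E\oplus_m H$ for some Hilbert space $H$ of arbitrary (possibly zero) dimension. 2. This class is uncountably categorical: it is closed under ultrapowers and under ultraroots (a Banach space $Y$ belongs to it as soon as some ultrapower of $Y$ does), and for some uncountable cardinal $\kappa$, hence in fact for every uncountable cardinal $\kappa$, it contains, up to linear isometry, exactly one member of density character $\kappa$. -/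

import Mathlib

open Filter Topology Set
open scoped ENNReal

universe u v w

namespace NakanoSums

noncomputable section

/-! ## Modular spaces and Luxemburg norms -/

/-- A (finite, faithful) convex modular on a linear space `X` over `𝕜 = ℝ` or `ℂ`. -/
structure ConvexModular (𝕜 : Type v) (X : Type w) [RCLike 𝕜] [AddCommGroup X] [Module 𝕜 X] where
  toFun : X → ℝ
  nonneg' : ∀ x, 0 ≤ toFun x
  map_zero' : toFun 0 = 0
  convex' : ∀ (x y : X) (a b : ℝ), 0 ≤ a → 0 ≤ b → a + b = 1 →
    toFun ((a : 𝕜) • x + (b : 𝕜) • y) ≤ a * toFun x + b * toFun y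
  symmetric' : ∀ (c : 𝕜) (x : X), ‖c‖ = 1 → toFun (c • x) = toFun x
  faithful' : ∀ x, toFun x = 0 → x = 0

namespace ConvexModular

variable {𝕜 : Type v} {X : Type w} [RCLike 𝕜] [AddCommGroup X] [Module 𝕜 X]

/-- The set of all `t > 0` with `Θ (x / t) ≤ 1`. -/
def gaugeSet (Θ : ConvexModular 𝕜 X) (x : X) : Set ℝ :=
  {t : ℝ | 0 < t ∧ Θ.toFun (((t⁻¹ : ℝ) : 𝕜) • x) ≤ 1}

/-- The Luxemburg norm `‖x‖ = inf {t > 0 : Θ (x / t) ≤ 1}`. -/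
def luxNorm (Θ : ConvexModular 𝕜 X) (x : X) : ℝ := sInf (Θ.gaugeSet x)

theorem shrink (Θ : ConvexModular 𝕜 X) (x : X) {a : ℝ} (h0 : 0 ≤ a) (h1 : a ≤ 1) :
    Θ.toFun ((a : 𝕜) • x) ≤ a * Θ.toFun x := by
  have h := Θ.convex' x 0 a (1 - a) h0 (by linarith) (by ring)
  simpa [Θ.map_zero'] using h

theorem gaugeSet_nonempty (Θ : ConvexModular 𝕜 X) (x : X) : (Θ.gaugeSet x).Nonempty := by
  have hn := Θ.nonneg' x
  refine ⟨1 + Θ.toFun x, by linarith, ?_⟩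
  have hp : 0 < 1 + Θ.toFun x := by linarith
  have h1 : (1 + Θ.toFun x)⁻¹ ≤ 1 := inv_le_one_of_one_le₀ (by linarith)
  refine (Θ.shrink x (by positivity) h1).trans ?_
  rw [inv_mul_le_iff₀ hp]
  linarith

theorem gaugeSet_bddBelow (Θ : ConvexModular 𝕜 X) (x : X) : BddBelow (Θ.gaugeSet x) :=
  ⟨0, fun _ ht => ht.1.le⟩

theorem luxNorm_nonneg (Θ : ConvexModular 𝕜 X) (x : X) : 0 ≤ Θ.luxNorm x :=
  Real.sInf_nonneg fun _ ht => ht.1.le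

theorem luxNorm_le (Θ : ConvexModular 𝕜 X) {x : X} {t : ℝ} (ht : t ∈ Θ.gaugeSet x) :
    Θ.luxNorm x ≤ t :=
  csInf_le (Θ.gaugeSet_bddBelow x) ht

theorem exists_lt (Θ : ConvexModular 𝕜 X) (x : X) {r : ℝ} (hr : Θ.luxNorm x < r) :
    ∃ t ∈ Θ.gaugeSet x, t < r :=
  exists_lt_of_csInf_lt (Θ.gaugeSet_nonempty x) hr

theorem luxNorm_zero (Θ : ConvexModular 𝕜 X) : Θ.luxNorm 0 = 0 := by
  refine le_antisymm (le_of_forall_pos_le_add fun ε hε => ?_) (Θ.luxNorm_nonneg 0)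
  rw [zero_add]
  exact Θ.luxNorm_le ⟨hε, by simp [Θ.map_zero']⟩

theorem luxNorm_add_le (Θ : ConvexModular 𝕜 X) (x y : X) :
    Θ.luxNorm (x + y) ≤ Θ.luxNorm x + Θ.luxNorm y := by
  refine le_of_forall_pos_le_add fun ε hε => ?_
  obtain ⟨s, hs, hs'⟩ := Θ.exists_lt x (lt_add_of_pos_right (Θ.luxNorm x) (half_pos hε))
  obtain ⟨t, ht, ht'⟩ := Θ.exists_lt y (lt_add_of_pos_right (Θ.luxNorm y) (half_pos hε))
  have hs0 := hs.1
  have ht0 := ht.1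
  have hst : 0 < s + t := add_pos hs0 ht0
  have key : s + t ∈ Θ.gaugeSet (x + y) := by
    refine ⟨hst, ?_⟩
    have hc := Θ.convex' (((s⁻¹ : ℝ) : 𝕜) • x) (((t⁻¹ : ℝ) : 𝕜) • y) (s / (s + t)) (t / (s + t))
      (by positivity) (by positivity) (by field_simp)
    rw [smul_smul, smul_smul, ← RCLike.ofReal_mul, ← RCLike.ofReal_mul,
      show s / (s + t) * s⁻¹ = (s + t)⁻¹ by field_simp,
      show t / (s + t) * t⁻¹ = (s + t)⁻¹ by field_simp, ← smul_add] at hc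
    refine hc.trans ?_
    have e : s / (s + t) + t / (s + t) = 1 := by field_simp
    have h1 : s / (s + t) * Θ.toFun (((s⁻¹ : ℝ) : 𝕜) • x) ≤ s / (s + t) * 1 :=
      mul_le_mul_of_nonneg_left hs.2 (by positivity)
    have h2 : t / (s + t) * Θ.toFun (((t⁻¹ : ℝ) : 𝕜) • y) ≤ t / (s + t) * 1 :=
      mul_le_mul_of_nonneg_left ht.2 (by positivity)
    linarith
  have := Θ.luxNorm_le key
  linarith

theorem luxNorm_smul_le (Θ : ConvexModular 𝕜 X) (c : 𝕜) (x : X) :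
    Θ.luxNorm (c • x) ≤ ‖c‖ * Θ.luxNorm x := by
  rcases eq_or_ne c 0 with rfl | hc
  · simp [Θ.luxNorm_zero]
  have hc0 : 0 < ‖c‖ := norm_pos_iff.2 hc
  rw [← div_le_iff₀' hc0]
  refine le_csInf (Θ.gaugeSet_nonempty x) fun t ht => ?_
  rw [div_le_iff₀' hc0]
  refine Θ.luxNorm_le ⟨mul_pos hc0 ht.1, ?_⟩
  have hcn : ((‖c‖ : ℝ) : 𝕜) ≠ 0 := by exact_mod_cast hc0.ne'
  have h := Θ.symmetric' (c * ((‖c‖ : ℝ) : 𝕜)⁻¹) (((t⁻¹ : ℝ) : 𝕜) • x)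
    (by rw [norm_mul, norm_inv, RCLike.norm_ofReal, abs_norm, mul_inv_cancel₀ hc0.ne'])
  have e : ((((‖c‖ * t)⁻¹ : ℝ)) : 𝕜) • c • x
      = (c * ((‖c‖ : ℝ) : 𝕜)⁻¹) • ((t⁻¹ : ℝ) : 𝕜) • x := by
    rw [smul_smul, smul_smul]
    congr 1
    rw [mul_inv, RCLike.ofReal_mul, RCLike.ofReal_inv]
    ring
  rw [e, h]
  exact ht.2

theorem luxNorm_neg (Θ : ConvexModular 𝕜 X) (x : X) : Θ.luxNorm (-x) = Θ.luxNorm x := by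
  have h : ∀ y, Θ.luxNorm (-y) ≤ Θ.luxNorm y := fun y => by
    simpa using Θ.luxNorm_smul_le (-1) y
  exact le_antisymm (h x) (by simpa using h (-x))

theorem eq_zero_of_luxNorm (Θ : ConvexModular 𝕜 X) (x : X) (hx : Θ.luxNorm x = 0) : x = 0 := by
  refine Θ.faithful' x (le_antisymm (le_of_forall_pos_le_add fun ε hε => ?_) (Θ.nonneg' x))
  obtain ⟨t, ht, ht'⟩ := Θ.exists_lt x (r := min ε 1) (by rw [hx]; positivity)
  have h := Θ.shrink (((t⁻¹ : ℝ) : 𝕜) • x) ht.1.le (ht'.le.trans (min_le_right _ _))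
  rw [smul_smul, ← RCLike.ofReal_mul, mul_inv_cancel₀ ht.1.ne', RCLike.ofReal_one, one_smul] at h
  have h2 : t * Θ.toFun (((t⁻¹ : ℝ) : 𝕜) • x) ≤ t * 1 :=
    mul_le_mul_of_nonneg_left ht.2 ht.1.le
  have h3 := min_le_left ε 1
  linarith

end ConvexModular

/-- The modular space `(X, Θ)`: the linear space `X` equipped with the Luxemburg norm of `Θ`. -/
def ModularSpace {𝕜 : Type v} {X : Type w} [RCLike 𝕜] [AddCommGroup X] [Module 𝕜 X]
    (_Θ : ConvexModular 𝕜 X) : Type w := X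

namespace ModularSpace

variable {𝕜 : Type v} {X : Type w} [RCLike 𝕜] [AddCommGroup X] [Module 𝕜 X]
  (Θ : ConvexModular 𝕜 X)

instance : AddCommGroup (ModularSpace Θ) := inferInstanceAs (AddCommGroup X)

instance : Module 𝕜 (ModularSpace Θ) := inferInstanceAs (Module 𝕜 X)

/-- The Luxemburg norm as a group norm. -/
def groupNorm : AddGroupNorm (ModularSpace Θ) where
  toFun x := Θ.luxNorm x
  map_zero' := Θ.luxNorm_zero
  add_le' := Θ.luxNorm_add_le
  neg' := Θ.luxNorm_neg
  eq_zero_of_map_eq_zero' := Θ.eq_zero_of_luxNorm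

instance : NormedAddCommGroup (ModularSpace Θ) := (groupNorm Θ).toNormedAddCommGroup

instance : NormedSpace 𝕜 (ModularSpace Θ) where
  norm_smul_le := Θ.luxNorm_smul_le

/-- The norm of the modular space is the Luxemburg norm. -/
theorem norm_eq (x : ModularSpace Θ) :
    ‖x‖ = sInf {t : ℝ | 0 < t ∧ Θ.toFun (((t⁻¹ : ℝ) : 𝕜) • (show X from x)) ≤ 1} := rfl

end ModularSpace

/-- The trivial modular `x ↦ ‖x‖ ^ 2` of a normed space. -/
def sqModular (𝕜 : Type v) (X : Type w) [RCLike 𝕜] [NormedAddCommGroup X] [NormedSpace 𝕜 X] :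
    ConvexModular 𝕜 X where
  toFun x := ‖x‖ ^ 2
  nonneg' x := by positivity
  map_zero' := by simp
  convex' x y a b ha hb hab := by
    have h : ‖(a : 𝕜) • x + (b : 𝕜) • y‖ ≤ a * ‖x‖ + b * ‖y‖ := by
      refine (norm_add_le _ _).trans (le_of_eq ?_)
      rw [norm_smul, norm_smul, RCLike.norm_ofReal, RCLike.norm_ofReal, abs_of_nonneg ha,
        abs_of_nonneg hb]
    have h2 := pow_le_pow_left₀ (norm_nonneg _) h 2
    refine h2.trans ?_
    obtain rfl : b = 1 - a := by linarith
    nlinarith [mul_nonneg (mul_nonneg ha hb) (sq_nonneg (‖x‖ - ‖y‖))]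
  symmetric' c x hc := by rw [norm_smul, hc, one_mul]
  faithful' x hx := by simpa using hx

/-- The modular `Θ (x₁, x₂) = Θ₁ x₁ + Θ₂ x₂` on the direct sum of two modular spaces. -/
def ConvexModular.directSum {𝕜 : Type v} {X₁ X₂ : Type w} [RCLike 𝕜]
    [AddCommGroup X₁] [Module 𝕜 X₁] [AddCommGroup X₂] [Module 𝕜 X₂]
    (Θ₁ : ConvexModular 𝕜 X₁) (Θ₂ : ConvexModular 𝕜 X₂) : ConvexModular 𝕜 (X₁ × X₂) where
  toFun x := Θ₁.toFun x.1 + Θ₂.toFun x.2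
  nonneg' x := add_nonneg (Θ₁.nonneg' _) (Θ₂.nonneg' _)
  map_zero' := by simp [Θ₁.map_zero', Θ₂.map_zero']
  convex' x y a b ha hb hab := by
    have h1 := Θ₁.convex' x.1 y.1 a b ha hb hab
    have h2 := Θ₂.convex' x.2 y.2 a b ha hb hab
    simp only [Prod.fst_add, Prod.snd_add, Prod.smul_fst, Prod.smul_snd]
    linarith
  symmetric' c x hc := by
    simp only [Prod.smul_fst, Prod.smul_snd, Θ₁.symmetric' c _ hc, Θ₂.symmetric' c _ hc]
  faithful' x hx := by
    have h1 := Θ₁.nonneg' x.1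
    have h2 := Θ₂.nonneg' x.2
    exact Prod.ext (Θ₁.faithful' _ (by linarith)) (Θ₂.faithful' _ (by linarith))

/-! ## Nakano direct sums -/

/-- An exponent sequence of a Nakano sequence space: a bounded sequence in `[1, ∞)`. -/
structure NakanoExponents where
  p : ℕ → ℝ
  one_le : ∀ n, 1 ≤ p n
  bddAbove : BddAbove (range p)

section Nakano

variable (𝕜 : Type v) [RCLike 𝕜] (e : NakanoExponents) (E : ℕ → Type w)
  [∀ n, NormedAddCommGroup (E n)] [∀ n, NormedSpace 𝕜 (E n)]

/-- The linear space of all `x ∈ ∏ n, E n` with `∑ n, ‖x n‖ ^ p n < ∞`. -/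
def nakanoSubmodule : Submodule 𝕜 (∀ n, E n) where
  carrier := {x | Summable fun n => ‖x n‖ ^ e.p n}
  zero_mem' := by
    have h : (fun n => ‖(0 : ∀ n, E n) n‖ ^ e.p n) = fun _ => (0 : ℝ) := by
      funext n
      have := e.one_le n
      rw [Pi.zero_apply, norm_zero, Real.zero_rpow (by linarith)]
    change Summable _
    rw [h]
    exact summable_zero
  add_mem' := by
    intro x y hx hy
    obtain ⟨M, hM⟩ := e.bddAbove
    refine Summable.of_nonneg_of_le (fun n => by positivity) (fun n => ?_)
      (((hx : Summable _).add hy).mul_left ((2 : ℝ) ^ M))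
    have h1 := e.one_le n
    have hpM : e.p n ≤ M := hM (mem_range_self n)
    have hmax : ‖x n + y n‖ ≤ 2 * max ‖x n‖ ‖y n‖ := by
      have := norm_add_le (x n) (y n)
      have := le_max_left ‖x n‖ ‖y n‖
      have := le_max_right ‖x n‖ ‖y n‖
      linarith
    have hm0 : 0 ≤ max ‖x n‖ ‖y n‖ := (norm_nonneg (x n)).trans (le_max_left _ _)
    have ha : 0 ≤ ‖x n‖ ^ e.p n := by positivity
    have hb : 0 ≤ ‖y n‖ ^ e.p n := by positivity
    have hm : max ‖x n‖ ‖y n‖ ^ e.p n ≤ ‖x n‖ ^ e.p n + ‖y n‖ ^ e.p n := by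
      rcases max_choice ‖x n‖ ‖y n‖ with h | h <;> rw [h] <;> linarith
    calc ‖(x + y) n‖ ^ e.p n ≤ (2 * max ‖x n‖ ‖y n‖) ^ e.p n :=
          Real.rpow_le_rpow (norm_nonneg _) hmax (by linarith)
      _ = 2 ^ e.p n * max ‖x n‖ ‖y n‖ ^ e.p n := Real.mul_rpow (by norm_num) hm0
      _ ≤ 2 ^ M * (‖x n‖ ^ e.p n + ‖y n‖ ^ e.p n) :=
          mul_le_mul (Real.rpow_le_rpow_of_exponent_le (by norm_num) hpM) hm
            (by positivity) (by positivity)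
  smul_mem' := by
    intro c x hx
    obtain ⟨M, hM⟩ := e.bddAbove
    refine Summable.of_nonneg_of_le (fun n => by positivity) (fun n => ?_)
      ((hx : Summable _).mul_left ((max 1 ‖c‖) ^ M))
    have h1 := e.one_le n
    have hpM : e.p n ≤ M := hM (mem_range_self n)
    have hc : ‖c‖ ^ e.p n ≤ (max 1 ‖c‖) ^ M :=
      (Real.rpow_le_rpow (norm_nonneg _) (le_max_right 1 ‖c‖) (by linarith)).trans
        (Real.rpow_le_rpow_of_exponent_le (le_max_left _ _) hpM)
    rw [Pi.smul_apply, norm_smul, Real.mul_rpow (norm_nonneg _) (norm_nonneg _)]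
    exact mul_le_mul_of_nonneg_right hc (by positivity)

/-- The Nakano modular `Θ x = ∑ n, ‖x n‖ ^ p n`. -/
def nakanoModular : ConvexModular 𝕜 (nakanoSubmodule 𝕜 e E) where
  toFun x := ∑' n, ‖(x : ∀ n, E n) n‖ ^ e.p n
  nonneg' x := tsum_nonneg fun n => by positivity
  map_zero' := by
    have h : ∀ n, ‖((0 : nakanoSubmodule 𝕜 e E) : ∀ n, E n) n‖ ^ e.p n = 0 := fun n => by
      have := e.one_le n
      rw [Submodule.coe_zero, Pi.zero_apply, norm_zero, Real.zero_rpow (by linarith)]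
    exact (tsum_congr h).trans tsum_zero
  convex' x y a b ha hb hab := by
    have hx : Summable fun n => ‖(x : ∀ n, E n) n‖ ^ e.p n := x.2
    have hy : Summable fun n => ‖(y : ∀ n, E n) n‖ ^ e.p n := y.2
    rw [← tsum_mul_left, ← tsum_mul_left, ← (hx.mul_left a).tsum_add (hy.mul_left b)]
    refine Summable.tsum_le_tsum (fun n => ?_) (((a : 𝕜) • x + (b : 𝕜) • y).2)
      ((hx.mul_left a).add (hy.mul_left b))
    have h1 := e.one_le n
    have h : ‖(a : 𝕜) • (x : ∀ n, E n) n + (b : 𝕜) • (y : ∀ n, E n) n‖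
        ≤ a * ‖(x : ∀ n, E n) n‖ + b * ‖(y : ∀ n, E n) n‖ := by
      refine (norm_add_le _ _).trans (le_of_eq ?_)
      rw [norm_smul, norm_smul, RCLike.norm_ofReal, RCLike.norm_ofReal, abs_of_nonneg ha,
        abs_of_nonneg hb]
    have h2 := (convexOn_rpow h1).2 (mem_Ici.2 (norm_nonneg ((x : ∀ n, E n) n)))
      (mem_Ici.2 (norm_nonneg ((y : ∀ n, E n) n))) ha hb hab
    simp only [smul_eq_mul] at h2
    exact (Real.rpow_le_rpow (norm_nonneg _) h (by linarith)).trans h2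
  symmetric' c x hc := by
    refine tsum_congr fun n => ?_
    rw [Submodule.coe_smul, Pi.smul_apply, norm_smul, hc, one_mul]
  faithful' x hx := by
    have hs : Summable fun n => ‖(x : ∀ n, E n) n‖ ^ e.p n := x.2
    have h0 := (hs.hasSum_iff.2 hx)
    rw [hasSum_zero_iff_of_nonneg (fun n => by positivity)] at h0
    ext n
    have h1 := e.one_le n
    have h2 : ‖(x : ∀ n, E n) n‖ ^ e.p n = 0 := congrFun h0 n
    rw [Real.rpow_eq_zero (norm_nonneg _) (by linarith)] at h2
    simpa using h2

/-- The Nakano direct sum `(⊕ n, E n)_N`, normed by the Luxemburg norm of the Nakano modular. -/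
abbrev NakanoSum : Type w := ModularSpace (nakanoModular 𝕜 e E)

/-- The modular direct sum `(⊕ n, E n)_N ⊕ₘ H`, where `H` carries the modular `h ↦ ‖h‖ ^ 2`. -/
abbrev NakanoSumPlus (H : Type w) [NormedAddCommGroup H] [NormedSpace 𝕜 H] : Type w :=
  ModularSpace ((nakanoModular 𝕜 e E).directSum (sqModular 𝕜 H))

end Nakano

/-! ## The Jordan-von Neumann constant -/

/-- `a(X) = (1/2) sup {‖x + y‖² + ‖x - y‖² : ‖x‖² + ‖y‖² = 1}`, the supremum being taken in
`[0, ∞)`; it is at least `1` for `X ≠ 0`, and it is `0` for the zero space. -/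
def jordanVonNeumann (X : Type w) [NormedAddCommGroup X] : ℝ :=
  1 / 2 * sSup {t : ℝ | ∃ x y : X, ‖x‖ ^ 2 + ‖y‖ ^ 2 = 1 ∧ t = ‖x + y‖ ^ 2 + ‖x - y‖ ^ 2}

/-! ## Ultrapowers of normed spaces -/

section Ultrapower

variable (𝕜 : Type v) [RCLike 𝕜] {I : Type w} (U : Ultrafilter I)
  (X : Type w) [NormedAddCommGroup X] [NormedSpace 𝕜 X]

/-- The subspace of those bounded families `(x i)` with `‖x i‖ → 0` along `U`. -/
def nullFamilies : Submodule 𝕜 (lp (fun _ : I => X) ∞) where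
  carrier := {x | Tendsto (fun i => ‖x i‖) U (𝓝 0)}
  zero_mem' := by simp
  add_mem' := by
    intro x y hx hy
    have h : Tendsto (fun i => ‖x i‖ + ‖y i‖) U (𝓝 0) := by
      simpa using Tendsto.add (mem_ofPred.1 hx) (mem_ofPred.1 hy)
    exact squeeze_zero (fun i => norm_nonneg _) (fun i => norm_add_le _ _) h
  smul_mem' := by
    intro c x hx
    have h : Tendsto (fun i => ‖c‖ * ‖x i‖) U (𝓝 0) := by
      simpa using Tendsto.const_mul ‖c‖ (mem_ofPred.1 hx)
    exact squeeze_zero (fun i => norm_nonneg _) (fun i => norm_smul_le _ _) h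

instance isClosed_nullFamilies :
    IsClosed (nullFamilies 𝕜 U X : Set (lp (fun _ : I => X) ∞)) := by
  refine isClosed_of_closure_subset fun x hx => ?_
  change Tendsto (fun i => ‖x i‖) U (𝓝 0)
  rw [Metric.tendsto_nhds]
  intro ε hε
  obtain ⟨y, hy, hxy⟩ := Metric.mem_closure_iff.1 hx (ε / 2) (half_pos hε)
  have hy' : Tendsto (fun i => ‖y i‖) U (𝓝 0) := hy
  filter_upwards [(Metric.tendsto_nhds.1 hy') (ε / 2) (half_pos hε)] with i hi
  have h1 : ‖x i - y i‖ ≤ ‖x - y‖ := lp.norm_apply_le_norm ENNReal.top_ne_zero (x - y) i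
  rw [dist_eq_norm] at hxy
  simp only [dist_zero_right, norm_norm] at hi ⊢
  have h2 : ‖x i‖ ≤ ‖x i - y i‖ + ‖y i‖ := by
    simpa using norm_add_le (x i - y i) (y i)
  linarith

/-- The ultrapower `X_U`: bounded families modulo null families, with the quotient norm. -/
abbrev Ultrapower : Type w := lp (fun _ : I => X) ∞ ⧸ nullFamilies 𝕜 U X

end Ultrapower

/-! ## Elementary classes and categoricity -/

/-- `X` and `Y` are elementarily equivalent: some ultrapower of `X` is linearly isometric to
some ultrapower of `Y`. -/
def ElementarilyEquivalent (𝕜 : Type v) [RCLike 𝕜] (X Y : Type w)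
    [NormedAddCommGroup X] [NormedSpace 𝕜 X] [NormedAddCommGroup Y] [NormedSpace 𝕜 Y] : Prop :=
  ∃ (I J : Type w) (U : Ultrafilter I) (V : Ultrafilter J),
    Nonempty (Ultrapower 𝕜 U X ≃ₗᵢ[𝕜] Ultrapower 𝕜 V Y)

/-- A Banach space over `𝕜`, with its underlying type in the universe `w`. -/
structure BanachSpace (𝕜 : Type v) [RCLike 𝕜] : Type (max v (w + 1)) where
  carrier : Type w
  [normedAddCommGroup : NormedAddCommGroup carrier]
  [normedSpace : NormedSpace 𝕜 carrier]
  [completeSpace : CompleteSpace carrier]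

attribute [instance] BanachSpace.normedAddCommGroup BanachSpace.normedSpace
  BanachSpace.completeSpace

/-- The class of all Banach spaces that are elementarily equivalent to `X`. -/
def elementaryClass (𝕜 : Type v) [RCLike 𝕜] (X : Type w) [NormedAddCommGroup X]
    [NormedSpace 𝕜 X] : Set (BanachSpace.{v, w} 𝕜) :=
  {Y | ElementarilyEquivalent 𝕜 Y.carrier X}

/-- The class of all Banach spaces linearly isometric to `(⊕ n, E n)_N ⊕ₘ H` for some Hilbert
space `H` (of arbitrary, possibly zero, dimension). -/
def modularSumClass (𝕜 : Type v) [RCLike 𝕜] (e : NakanoExponents) (E : ℕ → Type w)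
    [∀ n, NormedAddCommGroup (E n)] [∀ n, NormedSpace 𝕜 (E n)] : Set (BanachSpace.{v, w} 𝕜) :=
  {Y | ∃ (H : Type w) (_ : NormedAddCommGroup H) (_ : InnerProductSpace 𝕜 H)
      (_ : CompleteSpace H), Nonempty (Y.carrier ≃ₗᵢ[𝕜] NakanoSumPlus 𝕜 e E H)}

/-- The density character: the least cardinality of a dense subset. -/
def densityCharacter (X : Type w) [TopologicalSpace X] : Cardinal.{w} :=
  sInf {c | ∃ s : Set X, Dense s ∧ Cardinal.mk s = c}

/-- The class `C` contains, up to linear isometry, exactly one member of density character `κ`. -/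
def CategoricalIn (𝕜 : Type v) [RCLike 𝕜] (κ : Cardinal.{w}) (C : Set (BanachSpace.{v, w} 𝕜)) :
    Prop :=
  ∃ X ∈ C, densityCharacter X.carrier = κ ∧
    ∀ Y ∈ C, densityCharacter Y.carrier = κ → Nonempty (Y.carrier ≃ₗᵢ[𝕜] X.carrier)

/-- `C` contains every Banach space linearly isometric to an ultrapower of a member of `C`. -/
def ClosedUnderUltrapowers (𝕜 : Type v) [RCLike 𝕜] (C : Set (BanachSpace.{v, w} 𝕜)) : Prop :=
  ∀ X ∈ C, ∀ (I : Type w) (U : Ultrafilter I) (Y : BanachSpace.{v, w} 𝕜),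
    Nonempty (Ultrapower 𝕜 U X.carrier ≃ₗᵢ[𝕜] Y.carrier) → Y ∈ C

/-- `C` contains every Banach space of which some ultrapower is linearly isometric to a member
of `C`. -/
def ClosedUnderUltraroots (𝕜 : Type v) [RCLike 𝕜] (C : Set (BanachSpace.{v, w} 𝕜)) : Prop :=
  ∀ X ∈ C, ∀ (I : Type w) (U : Ultrafilter I) (Y : BanachSpace.{v, w} 𝕜),
    Nonempty (Ultrapower 𝕜 U Y.carrier ≃ₗᵢ[𝕜] X.carrier) → Y ∈ C

/-- A class of Banach spaces is uncountably categorical if it is closed under ultrapowers and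
ultraroots and contains, up to linear isometry, exactly one member of density character `κ`, for
some uncountable cardinal `κ`. -/
def UncountablyCategorical (𝕜 : Type v) [RCLike 𝕜] (C : Set (BanachSpace.{v, w} 𝕜)) : Prop :=
  ClosedUnderUltrapowers 𝕜 C ∧ ClosedUnderUltraroots 𝕜 C ∧
    ∃ κ : Cardinal.{w}, Cardinal.aleph0 < κ ∧ CategoricalIn 𝕜 κ C

end

end NakanoSums

/-! Write `E ⊕ₘ H` for the modular sums. The proof rests on four facts, and the elementary class
comes out of them without any general isomorphism theorem for ultrapowers.

Ultrapowers (`exists_ultrapower_equiv`). A bounded family in `E ⊕ₘ H` has coordinatewise limits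
along `U`, since the `E n` are finite-dimensional. Removing these limits, together with nothing in
`H`, leaves a family `r` whose coordinates in every `E n` tend to zero. Such a family lives
asymptotically where `p n` is close to `2` and `E n` is close to Euclidean, or in `H`. There the
modular is the square of the norm in the limit and the parallelogram law holds, so the classes of
these families form a Hilbert space `K`. Also `Θ (x + r i)` is asymptotically `Θ x + Θ (r i)`, hence
the ultrapower is `E ⊕ₘ K`.

Rigidity of isometries (`modular_map`, `exists_map_eq_of_mem_level`). Unit vectors of the `E n` are
weakly null, and adding a multiple `s` of them to `z` raises the modular by `s ^ 2` in the limit.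
The norms of these sums therefore reveal `Θ z`, so that every linear isometry `T` between modular
sums preserves the modular below level one. The finite-dimensional subspace spanned by the `E m`
with `p m = p n` consists of the vectors on which `Θ` is homogeneous of degree `p n ≠ 2`. So `T`
maps it into, and by dimension onto, the corresponding subspace.

Ultraroots (`exists_equiv_of_ultrapower_equiv`). If an ultrapower of `Y` is `E ⊕ₘ K`, then `Y`
embeds diagonally as a closed subspace `S`. Rigidity, applied to two embeddings of `E ⊕ₘ K` into its
own ultrapower, shows that `S` contains every `E n`. Hence `S = E ⊕ₘ (S ∩ K)`.

Density (`nonempty_equiv_of_densityCharacter_eq`, `densityCharacter_ultrapower`). As `E` is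
separable, an uncountable density character determines the dimension of `H`, which is categoricity.
For a suitable ultrafilter the ultrapowers of any two modular sums have the same uncountable density
character. They are again modular sums, so they are isometric. -/

namespace NakanoSums

noncomputable section

/-! ## Modulars of polynomial growth -/

/-- A modular has polynomial growth if `Θ (t x) ≤ t ^ M Θ x` for all `t ≥ 1` and some `M ≥ 1`. -/
class ConvexModular.PolynomialGrowth {𝕜 : Type v} {X : Type w} [RCLike 𝕜] [AddCommGroup X]
    [Module 𝕜 X] (Θ : ConvexModular 𝕜 X) : Prop where
  exists_growth : ∃ M : ℝ, 1 ≤ M ∧ ∀ t : ℝ, 1 ≤ t → ∀ x : X,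
    Θ.toFun ((t : 𝕜) • x) ≤ t ^ M * Θ.toFun x

namespace ModularSpace

variable {𝕜 : Type v} {X : Type w} [RCLike 𝕜] [AddCommGroup X] [Module 𝕜 X]
  {Θ : ConvexModular 𝕜 X}

/-- The modular as a function on the modular space. -/
def modular (x : ModularSpace Θ) : ℝ := Θ.toFun x

theorem modular_nonneg (x : ModularSpace Θ) : 0 ≤ modular x := Θ.nonneg' x

@[simp] theorem modular_zero : modular (0 : ModularSpace Θ) = 0 := Θ.map_zero'

theorem modular_smul_le (x : ModularSpace Θ) {a : ℝ} (h0 : 0 ≤ a) (h1 : a ≤ 1) :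
    modular ((a : 𝕜) • x) ≤ a * modular x := Θ.shrink x h0 h1

theorem modular_convex (x y : ModularSpace Θ) {a b : ℝ} (ha : 0 ≤ a) (hb : 0 ≤ b)
    (hab : a + b = 1) :
    modular ((a : 𝕜) • x + (b : 𝕜) • y) ≤ a * modular x + b * modular y :=
  Θ.convex' x y a b ha hb hab

theorem norm_le_of_modular_le (x : ModularSpace Θ) {t : ℝ} (ht : 0 < t)
    (h : modular (((t⁻¹ : ℝ) : 𝕜) • x) ≤ 1) : ‖x‖ ≤ t :=
  Θ.luxNorm_le ⟨ht, h⟩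

theorem norm_le_one_of_modular_le (x : ModularSpace Θ) (h : modular x ≤ 1) : ‖x‖ ≤ 1 :=
  norm_le_of_modular_le x one_pos (by simpa using h)

theorem ofReal_smul_smul (a b : ℝ) (x : ModularSpace Θ) :
    (a : 𝕜) • (b : 𝕜) • x = ((a * b : ℝ) : 𝕜) • x := by
  rw [smul_smul, RCLike.ofReal_mul]

theorem norm_ofReal_smul {F : Type*} [NormedAddCommGroup F] [NormedSpace 𝕜 F] {a : ℝ}
    (ha : 0 ≤ a) (x : F) : ‖(a : 𝕜) • x‖ = a * ‖x‖ := by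
  rw [norm_smul, RCLike.norm_ofReal, abs_of_nonneg ha]

theorem modular_inv_smul_le (x : ModularSpace Θ) {t : ℝ} (ht : ‖x‖ < t) :
    modular (((t⁻¹ : ℝ) : 𝕜) • x) ≤ 1 := by
  obtain ⟨s, hs, hst⟩ := Θ.exists_lt x ht
  have hs0 := hs.1
  have h := modular_smul_le (((s⁻¹ : ℝ) : 𝕜) • x) (a := s / t)
    (div_nonneg hs0.le (hs0.trans hst).le) ((div_le_one (hs0.trans hst)).2 hst.le)
  rw [ofReal_smul_smul, show s / t * s⁻¹ = t⁻¹ by field_simp] at h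
  have h1 : modular (((s⁻¹ : ℝ) : 𝕜) • x) ≤ 1 := hs.2
  have h2 : s / t ≤ 1 := (div_le_one (hs0.trans hst)).2 hst.le
  have h3 : 0 ≤ s / t := div_nonneg hs0.le (hs0.trans hst).le
  nlinarith [modular_nonneg (((s⁻¹ : ℝ) : 𝕜) • x)]

theorem norm_le_modular (x : ModularSpace Θ) (h : 1 ≤ modular x) : ‖x‖ ≤ modular x := by
  refine norm_le_of_modular_le x (by linarith) ?_
  refine (modular_smul_le x (by positivity) (inv_le_one_of_one_le₀ h)).trans ?_
  rw [inv_mul_cancel₀ (by linarith)]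

/-- A convex function bounded on a ball is Lipschitz inside it: `y` lies on the segment from `x` to
the point at distance one from `x` in the direction `y - x`, and `C` bounds the modular there. -/
theorem modular_le_add_mul {R C : ℝ} (hC : ∀ x : ModularSpace Θ, ‖x‖ ≤ R + 1 → modular x ≤ C)
    (x y : ModularSpace Θ) (hx : ‖x‖ ≤ R) (hxy : ‖y - x‖ ≤ 1) :
    modular y ≤ modular x + ‖y - x‖ * C := by
  rcases eq_or_ne (y - x) 0 with h0 | h0
  · rw [h0, sub_eq_zero.1 h0]; simp
  have hn : 0 < ‖y - x‖ := norm_pos_iff.2 h0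
  set d := ‖y - x‖ with hd
  have h1 := modular_convex x (x + ((d⁻¹ : ℝ) : 𝕜) • (y - x)) (a := 1 - d) (b := d)
    (by linarith) hn.le (by ring)
  have e : ((1 - d : ℝ) : 𝕜) • x + (d : 𝕜) • (x + ((d⁻¹ : ℝ) : 𝕜) • (y - x)) = y := by
    rw [smul_add, ofReal_smul_smul, mul_inv_cancel₀ hn.ne', RCLike.ofReal_sub, RCLike.ofReal_one,
      sub_smul]
    simp only [one_smul]
    abel
  rw [e] at h1
  have h2 : modular (x + ((d⁻¹ : ℝ) : 𝕜) • (y - x)) ≤ C := by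
    refine hC _ ((norm_add_le _ _).trans (add_le_add hx ?_))
    rw [norm_ofReal_smul (by positivity), ← hd, inv_mul_cancel₀ hn.ne']
  have h3 := modular_nonneg x
  nlinarith

variable [hΘ : Θ.PolynomialGrowth]

theorem modular_le_one_of_norm_le (x : ModularSpace Θ) (h : ‖x‖ ≤ 1) : modular x ≤ 1 := by
  obtain ⟨M, hM, hgrow⟩ := hΘ.exists_growth
  have key : ∀ t : ℝ, 1 < t → modular x ≤ t ^ M := fun t ht => by
    have h1 := hgrow t ht.le (((t⁻¹ : ℝ) : 𝕜) • x : ModularSpace Θ)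
    have h2 := modular_inv_smul_le x (h.trans_lt ht)
    have h3 : modular ((t : 𝕜) • (((t⁻¹ : ℝ) : 𝕜) • x : ModularSpace Θ)) ≤
      t ^ M * modular (((t⁻¹ : ℝ) : 𝕜) • x) := h1
    rw [ofReal_smul_smul, mul_inv_cancel₀ (by linarith), RCLike.ofReal_one, one_smul] at h3
    have : 0 < t ^ M := Real.rpow_pos_of_pos (by linarith) _
    nlinarith
  have hlim : Tendsto (fun t : ℝ => t ^ M) (𝓝[>] 1) (𝓝 (1 ^ M)) :=
    (Real.continuousAt_rpow_const 1 M (Or.inl one_ne_zero)).tendsto.mono_left nhdsWithin_le_nhds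
  rw [Real.one_rpow] at hlim
  exact ge_of_tendsto hlim (eventually_nhdsWithin_of_forall key)

theorem modular_le_norm (x : ModularSpace Θ) (h : ‖x‖ ≤ 1) : modular x ≤ ‖x‖ := by
  rcases (norm_nonneg x).eq_or_lt with h0 | h0
  · rw [norm_eq_zero.1 h0.symm]; simp
  · have h1 := modular_le_one_of_norm_le (((‖x‖⁻¹ : ℝ) : 𝕜) • x) (by
      rw [norm_ofReal_smul (by positivity), inv_mul_cancel₀ h0.ne'])
    have h2 := modular_smul_le (((‖x‖⁻¹ : ℝ) : 𝕜) • x) h0.le h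
    rw [ofReal_smul_smul, mul_inv_cancel₀ h0.ne', RCLike.ofReal_one, one_smul] at h2
    nlinarith

theorem norm_le_modular_of_one_le_norm (x : ModularSpace Θ) (h : 1 ≤ ‖x‖) : ‖x‖ ≤ modular x := by
  refine norm_le_modular x ?_
  by_contra! hlt
  have h1 := norm_le_one_of_modular_le x hlt.le
  have h2 := modular_le_norm x h1
  have h3 : ‖x‖ = 1 := le_antisymm h1 h
  obtain ⟨M, hM, hgrow⟩ := hΘ.exists_growth
  -- enlarge `x` slightly while keeping the modular at most one
  have hlim : Tendsto (fun t : ℝ => t ^ M * modular x) (𝓝[>] 1) (𝓝 (1 ^ M * modular x)) :=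
    ((Real.continuousAt_rpow_const 1 M (Or.inl one_ne_zero)).tendsto.mono_left
      nhdsWithin_le_nhds).mul_const _
  rw [Real.one_rpow, one_mul] at hlim
  obtain ⟨t, ht, ht1⟩ := ((hlim.eventually (gt_mem_nhds hlt)).and self_mem_nhdsWithin).exists
  have ht1 : 1 < t := ht1
  have h4 : modular ((t : 𝕜) • x) ≤ 1 := (hgrow t ht1.le x).trans ht.le
  have h5 := norm_le_one_of_modular_le _ h4
  rw [norm_ofReal_smul (by linarith), h3] at h5
  linarith

/-- The bridge from modulars to norms: a linear map is an isometry as soon as it preserves modular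
one, by `LinearMap.norm_map_of_norm_eq_one`. -/
theorem modular_eq_one_iff (x : ModularSpace Θ) : modular x = 1 ↔ ‖x‖ = 1 := by
  constructor <;> intro h
  · have h1 := norm_le_one_of_modular_le x h.le
    exact le_antisymm h1 (h ▸ modular_le_norm x h1)
  · exact le_antisymm (modular_le_one_of_norm_le x h.le)
      (h ▸ norm_le_modular_of_one_le_norm x h.ge)

theorem modular_inv_norm_smul (x : ModularSpace Θ) (hx : x ≠ 0) :
    modular (((‖x‖⁻¹ : ℝ) : 𝕜) • x) = 1 := by
  rw [modular_eq_one_iff, norm_ofReal_smul (by positivity), inv_mul_cancel₀ (norm_ne_zero_iff.2 hx)]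

/-- Comparison between the modular and the norm. -/
theorem exists_comparison (Θ : ConvexModular 𝕜 X) [hΘ : Θ.PolynomialGrowth] :
    ∃ M : ℝ, 1 ≤ M ∧ (∀ x : ModularSpace Θ, ‖x‖ ≤ 1 → ‖x‖ ^ M ≤ modular x) ∧
      ∀ x : ModularSpace Θ, 1 ≤ ‖x‖ → modular x ≤ ‖x‖ ^ M := by
  obtain ⟨M, hM, hgrow⟩ := hΘ.exists_growth
  refine ⟨M, hM, fun x hx => ?_, fun x hx => ?_⟩
  · rcases eq_or_ne x 0 with rfl | h0
    · simp [Real.zero_rpow (by linarith : M ≠ 0)]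
    have hn : 0 < ‖x‖ := norm_pos_iff.2 h0
    have h1 : modular (((‖x‖⁻¹ : ℝ) : 𝕜) • x) ≤ (‖x‖⁻¹) ^ M * modular x :=
      hgrow _ (one_le_inv_iff₀.2 ⟨hn, hx⟩) x
    rw [modular_inv_norm_smul x h0, Real.inv_rpow hn.le,
      le_inv_mul_iff₀ (Real.rpow_pos_of_pos hn _), mul_one] at h1
    exact h1
  · have h0 : x ≠ 0 := norm_pos_iff.1 (by linarith)
    have hn : 0 < ‖x‖ := norm_pos_iff.2 h0
    have h1 : modular ((‖x‖ : 𝕜) • (((‖x‖⁻¹ : ℝ) : 𝕜) • x)) ≤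
      ‖x‖ ^ M * modular (((‖x‖⁻¹ : ℝ) : 𝕜) • x) := hgrow _ hx _
    rwa [modular_inv_norm_smul x h0, ofReal_smul_smul, mul_inv_cancel₀ hn.ne', RCLike.ofReal_one,
      one_smul, mul_one] at h1

theorem tendsto_modular_zero {I : Type*} {l : Filter I} {x : I → ModularSpace Θ}
    (h : Tendsto (fun i => ‖x i‖) l (𝓝 0)) : Tendsto (fun i => modular (x i)) l (𝓝 0) := by
  refine squeeze_zero' (Eventually.of_forall fun i => modular_nonneg _) ?_ h
  filter_upwards [h.eventually (gt_mem_nhds one_pos)] with i hi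
  exact modular_le_norm _ hi.le

/-- On either side of norm one the modular is squeezed between `‖x i‖` and `‖x i‖ ^ M`, both of
which tend to one. -/
theorem tendsto_modular_one {I : Type*} {l : Filter I} {x : I → ModularSpace Θ}
    (h : Tendsto (fun i => ‖x i‖) l (𝓝 1)) : Tendsto (fun i => modular (x i)) l (𝓝 1) := by
  obtain ⟨M, hM, h1, h2⟩ := exists_comparison Θ
  have hp : Tendsto (fun i => ‖x i‖ ^ M) l (𝓝 1) := by
    simpa using h.rpow_const (p := M) (Or.inl one_ne_zero)
  have hmin : Tendsto (fun i => min ‖x i‖ (‖x i‖ ^ M)) l (𝓝 1) := by simpa using h.min hp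
  have hmax : Tendsto (fun i => max ‖x i‖ (‖x i‖ ^ M)) l (𝓝 1) := by simpa using h.max hp
  refine tendsto_of_tendsto_of_tendsto_of_le_of_le hmin hmax (fun i => ?_) (fun i => ?_)
  · rcases le_total ‖x i‖ 1 with hi | hi
    · exact (min_le_right _ _).trans (h1 _ hi)
    · exact (min_le_left _ _).trans (norm_le_modular_of_one_le_norm _ hi)
  · rcases le_total ‖x i‖ 1 with hi | hi
    · exact (modular_le_norm _ hi).trans (le_max_left _ _)
    · exact (h2 _ hi).trans (le_max_right _ _)

theorem tendsto_norm_one {I : Type*} {l : Filter I} {x : I → ModularSpace Θ}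
    (h : Tendsto (fun i => modular (x i)) l (𝓝 1)) : Tendsto (fun i => ‖x i‖) l (𝓝 1) := by
  obtain ⟨M, hM, h1, h2⟩ := exists_comparison Θ
  have hM0 : 0 < M := by linarith
  have hp : Tendsto (fun i => modular (x i) ^ M⁻¹) l (𝓝 1) := by
    simpa using h.rpow_const (p := M⁻¹) (Or.inl one_ne_zero)
  have hmin : Tendsto (fun i => min (modular (x i)) (modular (x i) ^ M⁻¹)) l (𝓝 1) := by
    simpa using h.min hp
  have hmax : Tendsto (fun i => max (modular (x i)) (modular (x i) ^ M⁻¹)) l (𝓝 1) := by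
    simpa using h.max hp
  refine tendsto_of_tendsto_of_tendsto_of_le_of_le hmin hmax (fun i => ?_) (fun i => ?_)
  · rcases le_total ‖x i‖ 1 with hi | hi
    · exact (min_le_left _ _).trans (modular_le_norm _ hi)
    · refine (min_le_right _ _).trans ?_
      rw [Real.rpow_inv_le_iff_of_pos (modular_nonneg _) (norm_nonneg _) hM0]
      exact h2 _ hi
  · rcases le_total ‖x i‖ 1 with hi | hi
    · refine le_trans ?_ (le_max_right _ _)
      rw [Real.le_rpow_inv_iff_of_pos (norm_nonneg _) (modular_nonneg _) hM0]
      exact h1 _ hi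
    · exact (norm_le_modular_of_one_le_norm _ hi).trans (le_max_left _ _)

theorem tendsto_norm_zero {I : Type*} {l : Filter I} {x : I → ModularSpace Θ}
    (h : Tendsto (fun i => modular (x i)) l (𝓝 0)) : Tendsto (fun i => ‖x i‖) l (𝓝 0) := by
  obtain ⟨M, hM, h1, h2⟩ := exists_comparison Θ
  have hM0 : 0 < M := by linarith
  have hp : Tendsto (fun i => modular (x i) ^ M⁻¹) l (𝓝 0) := by
    have := h.rpow_const (p := M⁻¹) (Or.inr (by positivity))
    rwa [Real.zero_rpow (by positivity)] at this
  refine squeeze_zero' (Eventually.of_forall fun i => norm_nonneg _) ?_ hp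
  filter_upwards [h.eventually (gt_mem_nhds one_pos)] with i hi
  rw [Real.le_rpow_inv_iff_of_pos (norm_nonneg _) (modular_nonneg _) hM0]
  exact h1 _ (norm_le_one_of_modular_le _ hi.le)

theorem exists_modular_le (Θ : ConvexModular 𝕜 X) [hΘ : Θ.PolynomialGrowth] (R : ℝ) :
    ∃ C : ℝ, 0 ≤ C ∧ ∀ x : ModularSpace Θ, ‖x‖ ≤ R → modular x ≤ C := by
  obtain ⟨M, hM, h1, h2⟩ := exists_comparison Θ
  refine ⟨max 1 R ^ M, by positivity, fun x hx => ?_⟩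
  rcases le_total ‖x‖ 1 with hi | hi
  · exact (modular_le_one_of_norm_le x hi).trans
      (Real.one_le_rpow (le_max_left _ _) (by linarith))
  · exact (h2 x hi).trans (Real.rpow_le_rpow (norm_nonneg _) (hx.trans (le_max_right _ _))
      (by linarith))

/-- The modular is uniformly continuous on bounded sets. -/
theorem exists_modular_sub_le (Θ : ConvexModular 𝕜 X) [hΘ : Θ.PolynomialGrowth] (R : ℝ) {ε : ℝ}
    (hε : 0 < ε) : ∃ δ > 0, ∀ x y : ModularSpace Θ, ‖x‖ ≤ R → ‖y‖ ≤ R → ‖y - x‖ ≤ δ →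
      |modular y - modular x| ≤ ε := by
  obtain ⟨C, hC0, hC⟩ := exists_modular_le Θ (R + 1)
  refine ⟨min 1 (ε / (C + 1)), by positivity, fun x y hx hy hxy => ?_⟩
  have hd1 := hxy.trans (min_le_left _ _)
  have hd2 := hxy.trans (min_le_right _ _)
  have h1 := modular_le_add_mul hC x y hx hd1
  have h2 := modular_le_add_mul hC y x hy (by rw [norm_sub_rev]; exact hd1)
  rw [norm_sub_rev] at h2
  have h3 : ‖y - x‖ * C ≤ ε := by
    rw [le_div_iff₀ (by linarith)] at hd2
    nlinarith [norm_nonneg (y - x)]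
  rw [abs_le]
  constructor <;> linarith

end ModularSpace

end

end NakanoSums

namespace NakanoSums

noncomputable section

open ModularSpace

/-! ## Coordinates of a modular direct sum -/

theorem _root_.LinearMap.norm_map_le_of_norm_eq_one {𝕜 : Type*} [RCLike 𝕜] {A B : Type*}
    [NormedAddCommGroup A] [NormedSpace 𝕜 A] [NormedAddCommGroup B] [NormedSpace 𝕜 B]
    (f : A →ₗ[𝕜] B) (h : ∀ x, ‖x‖ = 1 → ‖f x‖ ≤ 1) (x : A) : ‖f x‖ ≤ ‖x‖ := by
  rcases eq_or_ne x 0 with rfl | h0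
  · simp
  have hn : 0 < ‖x‖ := norm_pos_iff.2 h0
  have h1 := h (((‖x‖⁻¹ : ℝ) : 𝕜) • x) (by
    rw [norm_ofReal_smul (by positivity), inv_mul_cancel₀ hn.ne'])
  rwa [map_smul, norm_ofReal_smul (by positivity), inv_mul_le_iff₀ hn, mul_one] at h1

theorem _root_.LinearMap.norm_map_of_norm_eq_one {𝕜 : Type*} [RCLike 𝕜] {A B : Type*}
    [NormedAddCommGroup A] [NormedSpace 𝕜 A] [NormedAddCommGroup B] [NormedSpace 𝕜 B]
    (f : A →ₗ[𝕜] B) (h : ∀ x, ‖x‖ = 1 → ‖f x‖ = 1) (x : A) : ‖f x‖ = ‖x‖ := by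
  rcases eq_or_ne x 0 with rfl | h0
  · simp
  have hn : 0 < ‖x‖ := norm_pos_iff.2 h0
  have h1 := h (((‖x‖⁻¹ : ℝ) : 𝕜) • x) (by
    rw [norm_ofReal_smul (by positivity), inv_mul_cancel₀ hn.ne'])
  rwa [map_smul, norm_ofReal_smul (by positivity), inv_mul_eq_iff_eq_mul₀ hn.ne', mul_one] at h1

/-- The bound is at least `2` so that it also dominates the exponent of the component in `H`. -/
theorem NakanoExponents.exists_bound (e : NakanoExponents) : ∃ M : ℝ, 2 ≤ M ∧ ∀ n, e.p n ≤ M := by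
  obtain ⟨M, hM⟩ := e.bddAbove
  exact ⟨max 2 M, le_max_left _ _, fun n => (hM (mem_range_self n)).trans (le_max_right _ _)⟩

theorem NakanoExponents.pos (e : NakanoExponents) (n : ℕ) : 0 < e.p n := by
  linarith [e.one_le n]

namespace NakanoSumPlus

variable {𝕜 : Type v} [RCLike 𝕜] {e : NakanoExponents} {E : ℕ → Type w}
  [∀ n, NormedAddCommGroup (E n)] [∀ n, NormedSpace 𝕜 (E n)]
  {H : Type w} [NormedAddCommGroup H] [NormedSpace 𝕜 H]
  {K : Type w} [NormedAddCommGroup K] [NormedSpace 𝕜 K]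

variable (𝕜 e E H) in
/-- A modular direct sum is, as a linear space, a product. -/
def equivProd : NakanoSumPlus 𝕜 e E H ≃ₗ[𝕜] nakanoSubmodule 𝕜 e E × H := LinearEquiv.refl 𝕜 _

/-- The `n`-th coordinate. -/
def coord (n : ℕ) : NakanoSumPlus 𝕜 e E H →ₗ[𝕜] E n :=
  LinearMap.proj n ∘ₗ (nakanoSubmodule 𝕜 e E).subtype ∘ₗ LinearMap.fst 𝕜 _ _ ∘ₗ
    (equivProd 𝕜 e E H).toLinearMap

/-- The component in `H`. -/
def snd : NakanoSumPlus 𝕜 e E H →ₗ[𝕜] H :=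
  LinearMap.snd 𝕜 _ _ ∘ₗ (equivProd 𝕜 e E H).toLinearMap

/-- The inclusion of `H`. -/
def inr : H →ₗ[𝕜] NakanoSumPlus 𝕜 e E H :=
  (equivProd 𝕜 e E H).symm.toLinearMap ∘ₗ LinearMap.inr 𝕜 _ _

/-- The element with given coordinates. -/
def ofSeq (x : ∀ n, E n) (hx : Summable fun n => ‖x n‖ ^ e.p n) (h : H) :
    NakanoSumPlus 𝕜 e E H :=
  (equivProd 𝕜 e E H).symm (⟨x, hx⟩, h)

@[simp] theorem coord_ofSeq (x : ∀ n, E n) (hx : Summable fun n => ‖x n‖ ^ e.p n) (h : H) (n : ℕ) :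
    coord n (ofSeq (𝕜 := 𝕜) x hx h) = x n := rfl

@[simp] theorem snd_ofSeq (x : ∀ n, E n) (hx : Summable fun n => ‖x n‖ ^ e.p n) (h : H) :
    snd (ofSeq (𝕜 := 𝕜) x hx h) = h := rfl

@[simp] theorem coord_inr (h : H) (n : ℕ) : coord n (inr h : NakanoSumPlus 𝕜 e E H) = 0 := rfl

@[simp] theorem snd_inr (h : H) : snd (inr h : NakanoSumPlus 𝕜 e E H) = h := rfl

theorem ext {x y : NakanoSumPlus 𝕜 e E H} (h : ∀ n, coord n x = coord n y) (h' : snd x = snd y) :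
    x = y :=
  Prod.ext (Subtype.ext (funext h)) h'

theorem summable (x : NakanoSumPlus 𝕜 e E H) : Summable fun n => ‖coord n x‖ ^ e.p n :=
  (equivProd 𝕜 e E H x).1.2

theorem modular_eq (x : NakanoSumPlus 𝕜 e E H) :
    modular x = ∑' n, ‖coord n x‖ ^ e.p n + ‖snd x‖ ^ 2 := rfl

theorem norm_coord_rpow_le (x : NakanoSumPlus 𝕜 e E H) (n : ℕ) :
    ‖coord n x‖ ^ e.p n ≤ modular x := by
  rw [modular_eq]
  have := (summable x).le_tsum n fun m _ => Real.rpow_nonneg (norm_nonneg _) _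
  nlinarith [norm_nonneg (snd x)]

theorem sum_le_modular (x : NakanoSumPlus 𝕜 e E H) (s : Finset ℕ) :
    ∑ n ∈ s, ‖coord n x‖ ^ e.p n + ‖snd x‖ ^ 2 ≤ modular x := by
  rw [modular_eq]
  gcongr
  exact (summable x).sum_le_tsum _ fun m _ => Real.rpow_nonneg (norm_nonneg _) _

theorem norm_snd_sq_le (x : NakanoSumPlus 𝕜 e E H) : ‖snd x‖ ^ 2 ≤ modular x := by
  simpa using sum_le_modular x ∅

instance polynomialGrowth :
    ((nakanoModular 𝕜 e E).directSum (sqModular 𝕜 H)).PolynomialGrowth := by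
  obtain ⟨M, hM, hpM⟩ := e.exists_bound
  refine ⟨M, by linarith, fun t ht x => ?_⟩
  have h : ∀ x : NakanoSumPlus 𝕜 e E H, modular ((t : 𝕜) • x) ≤ t ^ M * modular x := fun x => by
    have ht0 : 0 ≤ t := by linarith
    rw [modular_eq, modular_eq, mul_add, ← tsum_mul_left]
    refine add_le_add (Summable.tsum_le_tsum (fun n => ?_) (summable _)
      ((summable x).mul_left _)) ?_
    · rw [map_smul, norm_ofReal_smul ht0, Real.mul_rpow ht0 (norm_nonneg _)]
      gcongr
      exact hpM n
    · rw [map_smul, norm_ofReal_smul ht0, mul_pow, ← Real.rpow_two t]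
      gcongr
  exact h x

theorem norm_coord_le (x : NakanoSumPlus 𝕜 e E H) (n : ℕ) : ‖coord n x‖ ≤ ‖x‖ := by
  refine (coord n).norm_map_le_of_norm_eq_one (fun x hx => ?_) x
  have h := (norm_coord_rpow_le x n).trans (modular_le_one_of_norm_le x hx.le)
  by_contra! h1
  exact absurd h (not_le.2 (Real.one_lt_rpow h1 (e.pos n)))

theorem norm_snd_le (x : NakanoSumPlus 𝕜 e E H) : ‖snd x‖ ≤ ‖x‖ := by
  refine snd.norm_map_le_of_norm_eq_one (fun x hx => ?_) x
  have h := (norm_snd_sq_le x).trans (modular_le_one_of_norm_le x hx.le)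
  exact (pow_le_one_iff_of_nonneg (norm_nonneg _) two_ne_zero).1 h

variable (𝕜 e E H) in
/-- The coordinate as a continuous linear map. -/
def coordL (n : ℕ) : NakanoSumPlus 𝕜 e E H →L[𝕜] E n :=
  (coord n).mkContinuous 1 fun x => by simpa using norm_coord_le x n

variable (𝕜 e E H) in
/-- The component in `H` as a continuous linear map. -/
def sndL : NakanoSumPlus 𝕜 e E H →L[𝕜] H :=
  snd.mkContinuous 1 fun x => by simpa using norm_snd_le x

theorem summable_of_forall_notMem {f : ℕ → ℝ} (s : Finset ℕ) (h : ∀ n ∉ s, f n = 0) :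
    Summable fun n => f n ^ e.p n :=
  summable_of_ne_finset_zero (s := s) fun n hn => by rw [h n hn, Real.zero_rpow (e.pos n).ne']

/-- The inclusion of `E n`. -/
def single (n : ℕ) : E n →ₗ[𝕜] NakanoSumPlus 𝕜 e E H where
  toFun v := ofSeq (Pi.single n v)
    (summable_of_forall_notMem {n} fun m hm => by
      rw [Pi.single_eq_of_ne (by simpa using hm), norm_zero]) 0
  map_add' v w := ext (fun m => by simp [Pi.single_add]) (by simp)
  map_smul' c v := ext (fun m => by simp [Pi.single_smul]) (by simp)

theorem coord_single (n m : ℕ) (v : E n) :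
    coord m (single n v : NakanoSumPlus 𝕜 e E H) = Pi.single n v m := rfl

@[simp] theorem coord_single_same (n : ℕ) (v : E n) :
    coord n (single n v : NakanoSumPlus 𝕜 e E H) = v := by simp [coord_single]

theorem coord_single_of_ne {n m : ℕ} (h : m ≠ n) (v : E n) :
    coord m (single n v : NakanoSumPlus 𝕜 e E H) = 0 := by
  rw [coord_single, Pi.single_eq_of_ne h]

@[simp] theorem snd_single (n : ℕ) (v : E n) :
    snd (single n v : NakanoSumPlus 𝕜 e E H) = 0 := rfl

theorem modular_eq_sum (x : NakanoSumPlus 𝕜 e E H) (s : Finset ℕ) (h : ∀ n ∉ s, coord n x = 0) :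
    modular x = ∑ n ∈ s, ‖coord n x‖ ^ e.p n + ‖snd x‖ ^ 2 := by
  rw [modular_eq, tsum_eq_sum (s := s)]
  intro n hn
  rw [h n hn, norm_zero, Real.zero_rpow (e.pos n).ne']

theorem modular_single (n : ℕ) (v : E n) :
    modular (single n v : NakanoSumPlus 𝕜 e E H) = ‖v‖ ^ e.p n := by
  rw [modular_eq_sum _ {n} fun m hm => coord_single_of_ne (by simpa using hm) v]
  simp

theorem norm_single (n : ℕ) (v : E n) : ‖(single n v : NakanoSumPlus 𝕜 e E H)‖ = ‖v‖ := by
  refine (single n : E n →ₗ[𝕜] NakanoSumPlus 𝕜 e E H).norm_map_of_norm_eq_one (fun v hv => ?_) v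
  rw [← modular_eq_one_iff, modular_single, hv, Real.one_rpow]

theorem norm_inr (h : H) : ‖(inr h : NakanoSumPlus 𝕜 e E H)‖ = ‖h‖ := by
  refine (inr : H →ₗ[𝕜] NakanoSumPlus 𝕜 e E H).norm_map_of_norm_eq_one (fun h hh => ?_) h
  rw [← modular_eq_one_iff, modular_eq_sum _ ∅ (by simp)]
  simp [hh]

/-- The map which keeps the coordinates and replaces the component in `H` by zero. -/
def seqPart : NakanoSumPlus 𝕜 e E K →ₗ[𝕜] NakanoSumPlus 𝕜 e E H where
  toFun x := ofSeq (fun n => coord n x) (summable x) 0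
  map_add' x y := ext (fun m => by simp) (by simp)
  map_smul' c x := ext (fun m => by simp) (by simp)

@[simp] theorem coord_seqPart (x : NakanoSumPlus 𝕜 e E K) (n : ℕ) :
    coord n (seqPart x : NakanoSumPlus 𝕜 e E H) = coord n x := rfl

@[simp] theorem snd_seqPart (x : NakanoSumPlus 𝕜 e E K) :
    snd (seqPart x : NakanoSumPlus 𝕜 e E H) = 0 := rfl

theorem seqPart_add_inr (x : NakanoSumPlus 𝕜 e E H) : seqPart x + inr (snd x) = x :=
  ext (by simp) (by simp)

/-- The element with the same first `N` coordinates and the same component in `H`. -/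
def trunc (N : ℕ) (x : NakanoSumPlus 𝕜 e E H) : NakanoSumPlus 𝕜 e E H :=
  ∑ n ∈ Finset.range N, single n (coord n x) + inr (snd x)

theorem coord_trunc (N : ℕ) (x : NakanoSumPlus 𝕜 e E H) (n : ℕ) :
    coord n (trunc N x) = if n < N then coord n x else 0 := by
  have h : ∀ m, coord n (single m (coord m x) : NakanoSumPlus 𝕜 e E H)
      = if n = m then coord n x else 0 := fun m => by
    split_ifs with h
    · subst h; simp
    · exact coord_single_of_ne h _
  simp [trunc, map_sum, h]

@[simp] theorem snd_trunc (N : ℕ) (x : NakanoSumPlus 𝕜 e E H) : snd (trunc N x) = snd x := by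
  simp [trunc, map_sum]

theorem tendsto_trunc (x : NakanoSumPlus 𝕜 e E H) :
    Tendsto (fun N => trunc N x) atTop (𝓝 x) := by
  rw [tendsto_iff_norm_sub_tendsto_zero]
  refine tendsto_norm_zero ?_
  have h : ∀ N, modular (trunc N x - x) = ∑' n, ‖coord (n + N) x‖ ^ e.p (n + N) := fun N => by
    rw [modular_eq, ← (summable (trunc N x - x)).sum_add_tsum_nat_add N]
    have h1 : ∑ n ∈ Finset.range N, ‖coord n (trunc N x - x)‖ ^ e.p n = 0 := by
      refine Finset.sum_eq_zero fun n hn => ?_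
      rw [map_sub, coord_trunc, if_pos (Finset.mem_range.1 hn), sub_self, norm_zero,
        Real.zero_rpow (e.pos n).ne']
    rw [h1, map_sub, snd_trunc]
    simp [coord_trunc]
  simp only [h]
  exact tendsto_sum_nat_add fun n => ‖coord n x‖ ^ e.p n

/-- The truncations of `x` lie in `S` and converge to `x`. -/
theorem mem_of_forall_single_mem (S : Submodule 𝕜 (NakanoSumPlus 𝕜 e E H))
    (hS : IsClosed (S : Set (NakanoSumPlus 𝕜 e E H))) (h : ∀ n (v : E n), single n v ∈ S)
    (x : NakanoSumPlus 𝕜 e E H) (hx : inr (snd x) ∈ S) : x ∈ S :=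
  hS.mem_of_tendsto (tendsto_trunc x) <| Eventually.of_forall fun _ =>
    S.add_mem (S.sum_mem fun _ _ => h _ _) hx

/-! ### Completeness -/

theorem sum_rpow_le_of_tendsto_coord {I : Type*} {l : Filter I} [l.NeBot]
    {x : I → NakanoSumPlus 𝕜 e E H} {C : ℝ} (hC : ∀ᶠ i in l, modular (x i) ≤ C) {y : ∀ n, E n}
    (hy : ∀ n, Tendsto (fun i => coord n (x i)) l (𝓝 (y n))) (s : Finset ℕ) :
    ∑ n ∈ s, ‖y n‖ ^ e.p n ≤ C := by
  refine le_of_tendsto (tendsto_finsetSum s fun n _ =>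
    ((hy n).norm.rpow_const (p := e.p n) (Or.inr (e.pos n).le))) ?_
  filter_upwards [hC] with i hi
  have := sum_le_modular (x i) s
  nlinarith [norm_nonneg (snd (x i))]

theorem summable_of_tendsto_coord {I : Type*} {l : Filter I} [l.NeBot]
    {x : I → NakanoSumPlus 𝕜 e E H} {C : ℝ} (hC : ∀ᶠ i in l, modular (x i) ≤ C) {y : ∀ n, E n}
    (hy : ∀ n, Tendsto (fun i => coord n (x i)) l (𝓝 (y n))) :
    Summable fun n => ‖y n‖ ^ e.p n :=
  summable_of_sum_le (fun _ => Real.rpow_nonneg (norm_nonneg _) _)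
    (sum_rpow_le_of_tendsto_coord hC hy)

/-- The modular is lower semicontinuous for coordinatewise convergence. -/
theorem modular_le_of_tendsto {I : Type*} {l : Filter I} [l.NeBot]
    {x : I → NakanoSumPlus 𝕜 e E H} {C : ℝ} (hC : ∀ᶠ i in l, modular (x i) ≤ C)
    {y : NakanoSumPlus 𝕜 e E H}
    (hy : ∀ n, Tendsto (fun i => coord n (x i)) l (𝓝 (coord n y)))
    (hy' : Tendsto (fun i => snd (x i)) l (𝓝 (snd y))) : modular y ≤ C := by
  rw [modular_eq, ← le_sub_iff_add_le]
  refine (summable y).tsum_le_of_sum_le fun s => ?_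
  rw [le_sub_iff_add_le]
  refine le_of_tendsto ((tendsto_finsetSum s fun n _ =>
    ((hy n).norm.rpow_const (p := e.p n) (Or.inr (e.pos n).le))).add (hy'.norm.pow 2)) ?_
  filter_upwards [hC] with i hi using (sum_le_modular (x i) s).trans hi

instance [∀ n, CompleteSpace (E n)] [CompleteSpace H] :
    CompleteSpace (NakanoSumPlus 𝕜 e E H) := by
  refine Metric.complete_of_cauchySeq_tendsto fun x hx => ?_
  have hcoord : ∀ n, ∃ y, Tendsto (fun i => coord n (x i)) atTop (𝓝 y) := fun n =>
    cauchySeq_tendsto_of_complete (hx.map (coordL 𝕜 e E H n).uniformContinuous)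
  choose y hy using hcoord
  have hsnd : CauchySeq fun i => snd (x i) := hx.map (sndL 𝕜 e E H).uniformContinuous
  obtain ⟨h, hh⟩ := cauchySeq_tendsto_of_complete hsnd
  obtain ⟨R, hR⟩ := hx.norm_bddAbove
  obtain ⟨C, -, hC⟩ := exists_modular_le ((nakanoModular 𝕜 e E).directSum (sqModular 𝕜 H)) R
  have hsum := summable_of_tendsto_coord
    (Eventually.of_forall fun i => hC (x i) (hR (mem_range_self i))) hy
  refine ⟨ofSeq y hsum h, ?_⟩
  rw [Metric.tendsto_atTop]
  intro ε hε
  obtain ⟨N, hN⟩ := Metric.cauchySeq_iff.1 hx (ε / 2) (half_pos hε)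
  refine ⟨N, fun n hn => ?_⟩
  rw [dist_eq_norm]
  refine lt_of_le_of_lt ?_ (half_lt_self hε)
  refine norm_le_of_modular_le _ (half_pos hε) ?_
  -- The Cauchy estimate for `x n - x m` survives the limit in `m`, which is only known
  -- coordinatewise, by lower semicontinuity.
  refine modular_le_of_tendsto (l := atTop)
    (x := fun m => (((ε / 2)⁻¹ : ℝ) : 𝕜) • (x n - x m)) ?_ (fun k => ?_) ?_
  · filter_upwards [eventually_ge_atTop N] with m hm
    exact modular_inv_smul_le _ (by simpa [dist_eq_norm] using hN n hn m hm)
  · simpa using ((hy k).const_sub (coord k (x n))).const_smul (((ε / 2)⁻¹ : ℝ) : 𝕜)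
  · simpa using (hh.const_sub (snd (x n))).const_smul (((ε / 2)⁻¹ : ℝ) : 𝕜)

end NakanoSumPlus

end

end NakanoSums

namespace NakanoSums

noncomputable section

open ModularSpace

/-! ## Asymptotically Hilbertian sequences of spaces -/

section JordanVonNeumann

theorem sq_add_sq_le_jordanVonNeumann (𝕜 : Type v) [RCLike 𝕜] {X : Type w} [NormedAddCommGroup X]
    [NormedSpace 𝕜 X] (x y : X) :
    ‖x + y‖ ^ 2 + ‖x - y‖ ^ 2 ≤ 2 * jordanVonNeumann X * (‖x‖ ^ 2 + ‖y‖ ^ 2) := by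
  set A : Set ℝ := {t : ℝ | ∃ x y : X, ‖x‖ ^ 2 + ‖y‖ ^ 2 = 1 ∧ t = ‖x + y‖ ^ 2 + ‖x - y‖ ^ 2}
  -- The real `sSup` of an unbounded set is zero, so boundedness is needed. Each of the two squares
  -- is at most `(‖x‖ + ‖y‖) ^ 2 ≤ 2`.
  have hA : BddAbove A := by
    refine ⟨4, ?_⟩
    rintro t ⟨x, y, hxy, rfl⟩
    have h1 := norm_add_le x y
    have h2 := norm_sub_le x y
    nlinarith [norm_nonneg (x + y), norm_nonneg (x - y), sq_nonneg (‖x‖ - ‖y‖)]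
  have hj : 2 * jordanVonNeumann X = sSup A := by
    change 2 * (1 / 2 * sSup A) = sSup A
    ring
  rw [hj]
  have hc0 : 0 ≤ ‖x‖ ^ 2 + ‖y‖ ^ 2 := by positivity
  rcases hc0.eq_or_lt with h0 | h0
  · have hx : x = 0 := by
      rw [← norm_eq_zero, ← sq_eq_zero_iff]
      nlinarith [sq_nonneg ‖x‖, sq_nonneg ‖y‖]
    have hy : y = 0 := by
      rw [← norm_eq_zero, ← sq_eq_zero_iff]
      nlinarith [sq_nonneg ‖x‖, sq_nonneg ‖y‖]
    simp [hx, hy]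
  set c := √(‖x‖ ^ 2 + ‖y‖ ^ 2) with hc
  have hcp : 0 < c := Real.sqrt_pos.2 h0
  have hc2 : c ^ 2 = ‖x‖ ^ 2 + ‖y‖ ^ 2 := Real.sq_sqrt hc0
  have hi : 0 ≤ c⁻¹ := by positivity
  have hmem : c⁻¹ ^ 2 * (‖x + y‖ ^ 2 + ‖x - y‖ ^ 2) ∈ A := by
    refine ⟨((c⁻¹ : ℝ) : 𝕜) • x, ((c⁻¹ : ℝ) : 𝕜) • y, ?_, ?_⟩
    · rw [norm_ofReal_smul hi, norm_ofReal_smul hi, mul_pow, mul_pow, ← mul_add, ← hc2]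
      field_simp
    · rw [← smul_add, ← smul_sub, norm_ofReal_smul hi, norm_ofReal_smul hi]
      ring
  have h := le_csSup hA hmem
  rw [inv_pow, inv_mul_le_iff₀ (by positivity), hc2] at h
  linarith

variable {𝕜 : Type v} [RCLike 𝕜] {e : NakanoExponents} {E : ℕ → Type w}
  [∀ n, NormedAddCommGroup (E n)] [∀ n, NormedSpace 𝕜 (E n)]

/-- If `a (E n) → 1`, then `E n` contains a unit vector for all large `n`. -/
theorem eventually_exists_norm_eq_one (𝕜 : Type v) [RCLike 𝕜] [∀ n, NormedSpace 𝕜 (E n)]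
    (hE : Tendsto (fun n => jordanVonNeumann (E n)) atTop (𝓝 1)) :
    ∀ᶠ n in atTop, ∃ u : E n, ‖u‖ = 1 := by
  filter_upwards [hE.eventually (lt_mem_nhds one_pos)] with n hn
  have : Nontrivial (E n) := by
    by_contra h
    rw [not_nontrivial_iff_subsingleton] at h
    have h0 : jordanVonNeumann (E n) = 0 := by
      have : {t : ℝ | ∃ x y : E n, ‖x‖ ^ 2 + ‖y‖ ^ 2 = 1 ∧ t = ‖x + y‖ ^ 2 + ‖x - y‖ ^ 2} = ∅ := by
        ext t
        simp [Subsingleton.elim _ (0 : E n)]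
      rw [jordanVonNeumann, this, Real.sSup_empty, mul_zero]
    exact hn.ne' h0
  obtain ⟨x, hx⟩ := exists_ne (0 : E n)
  exact ⟨_, norm_smul_inv_norm (𝕜 := 𝕜) hx⟩

/-- Joint continuity of the power at `(2, t)`, valid also for `t = 0` because the exponent is
positive, is made uniform by compactness. The interval `[0, 2]` accommodates the norms of sums and
differences of two vectors of the unit ball. -/
theorem eventually_abs_rpow_sub_sq_le {δ : ℝ} (hδ : 0 < δ) :
    ∀ᶠ p in 𝓝 (2 : ℝ), ∀ t ∈ Icc (0 : ℝ) 2, |t ^ p - t ^ 2| ≤ δ := by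
  refine isCompact_Icc.eventually_forall_of_forall_eventually fun t ht => ?_
  have hc : ContinuousAt (fun z : ℝ × ℝ => z.2 ^ z.1 - z.2 ^ 2) (2, t) := by
    refine ContinuousAt.sub (ContinuousAt.rpow continuousAt_snd continuousAt_fst ?_)
      (continuousAt_snd.pow 2)
    exact Or.inr two_pos
  have h : Tendsto (fun z : ℝ × ℝ => z.2 ^ z.1 - z.2 ^ 2) (𝓝 (2, t)) (𝓝 0) := by
    simpa using hc.tendsto
  filter_upwards [Metric.tendsto_nhds.1 h δ hδ] with z hz
  simpa using hz.le

/-- The parallelogram inequality holds asymptotically for the powers `‖·‖ ^ p n`. -/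
theorem eventually_rpow_add_rpow_le (𝕜 : Type v) [RCLike 𝕜] [∀ n, NormedSpace 𝕜 (E n)]
    (hp : Tendsto e.p atTop (𝓝 2))
    (hE : Tendsto (fun n => jordanVonNeumann (E n)) atTop (𝓝 1)) {ε : ℝ} (hε : 0 < ε) :
    ∀ᶠ n in atTop, ∀ x y : E n,
      ‖x + y‖ ^ e.p n + ‖x - y‖ ^ e.p n - 2 * (‖x‖ ^ e.p n + ‖y‖ ^ e.p n)
        ≤ ε * (‖x‖ ^ e.p n + ‖y‖ ^ e.p n) := by
  -- With `X`, `Y` the two powers below, the errors add up to at most `12 * δ * (X + Y)`, since `δ ≤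
  -- 1` and `1 ≤ X + Y` after normalization.
  set δ := min 1 (ε / 20) with hδ
  have hδ0 : 0 < δ := by positivity
  have hδ1 : δ ≤ 1 := min_le_left _ _
  have hδε : δ ≤ ε / 20 := min_le_right _ _
  filter_upwards [hp.eventually (eventually_abs_rpow_sub_sq_le hδ0),
    hE.eventually (gt_mem_nhds (lt_add_of_pos_right 1 hδ0))] with n hn ha x y
  have hp0 := e.pos n
  -- by homogeneity we may assume that the larger norm is one
  have key : ∀ x y : E n, max ‖x‖ ‖y‖ = 1 →
      ‖x + y‖ ^ e.p n + ‖x - y‖ ^ e.p n - 2 * (‖x‖ ^ e.p n + ‖y‖ ^ e.p n)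
        ≤ ε * (‖x‖ ^ e.p n + ‖y‖ ^ e.p n) := by
    intro x y hxy
    have hx : ‖x‖ ≤ 1 := hxy ▸ le_max_left _ _
    have hy : ‖y‖ ≤ 1 := hxy ▸ le_max_right _ _
    have h1 := abs_le.1 (hn ‖x‖ ⟨norm_nonneg _, by linarith⟩)
    have h2 := abs_le.1 (hn ‖y‖ ⟨norm_nonneg _, by linarith⟩)
    have h3 := abs_le.1 (hn ‖x + y‖ ⟨norm_nonneg _, by linarith [norm_add_le x y]⟩)
    have h4 := abs_le.1 (hn ‖x - y‖ ⟨norm_nonneg _, by linarith [norm_sub_le x y]⟩)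
    have h5 := sq_add_sq_le_jordanVonNeumann 𝕜 x y
    have hs : 1 ≤ ‖x‖ ^ e.p n + ‖y‖ ^ e.p n := by
      have hx0 : 0 ≤ ‖x‖ ^ e.p n := by positivity
      have hy0 : 0 ≤ ‖y‖ ^ e.p n := by positivity
      rcases max_choice ‖x‖ ‖y‖ with h | h
      · rw [h] at hxy
        rw [hxy, Real.one_rpow]; linarith
      · rw [h] at hxy
        rw [hxy, Real.one_rpow]; linarith
    have h6 : 2 * jordanVonNeumann (E n) * (‖x‖ ^ 2 + ‖y‖ ^ 2)
        ≤ 2 * (1 + δ) * (‖x‖ ^ 2 + ‖y‖ ^ 2) := by gcongr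
    set X := ‖x‖ ^ e.p n
    set Y := ‖y‖ ^ e.p n
    have h7 : 2 * (1 + δ) * (‖x‖ ^ 2 + ‖y‖ ^ 2) ≤ 2 * (1 + δ) * (X + Y + 2 * δ) := by
      refine mul_le_mul_of_nonneg_left ?_ (by linarith)
      linarith
    nlinarith
  rcases eq_or_ne (max ‖x‖ ‖y‖) 0 with h0 | h0
  · have hx : x = 0 := norm_le_zero_iff.1 (h0 ▸ le_max_left _ _)
    have hy : y = 0 := norm_le_zero_iff.1 (h0 ▸ le_max_right _ _)
    simp [hx, hy, Real.zero_rpow hp0.ne']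
  have hm : 0 < max ‖x‖ ‖y‖ := lt_of_le_of_ne ((norm_nonneg x).trans (le_max_left _ _)) h0.symm
  set m := max ‖x‖ ‖y‖ with hmdef
  have hi : 0 ≤ m⁻¹ := by positivity
  have h := key (((m⁻¹ : ℝ) : 𝕜) • x) (((m⁻¹ : ℝ) : 𝕜) • y) (by
    rw [norm_ofReal_smul hi, norm_ofReal_smul hi, ← mul_max_of_nonneg _ _ hi, ← hmdef,
      inv_mul_cancel₀ h0])
  simp only [← smul_add, ← smul_sub, norm_ofReal_smul hi, Real.mul_rpow hi (norm_nonneg _)] at h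
  have hq : 0 < m⁻¹ ^ e.p n := by positivity
  refine le_of_mul_le_mul_left ?_ hq
  linarith

end JordanVonNeumann

/-! ## Asymptotics of coordinatewise null families -/

/-- A substitute for dominated convergence without a fixed majorant: the tails of `A i` are
uniformly small multiples of those of `B i`, whose sums stay below `C`, and the finitely many
remaining terms tend to zero. -/
theorem tendsto_tsum_zero_of_tail {I : Type*} {l : Filter I} {A B : I → ℕ → ℝ} {C : ℝ}
    (hA : ∀ i, Summable (A i)) (hB : ∀ i, Summable (B i)) (hB0 : ∀ i n, 0 ≤ B i n)
    (hC : ∀ i, ∑' n, B i n ≤ C) (hlim : ∀ n, Tendsto (fun i => A i n) l (𝓝 0))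
    (htail : ∀ δ > 0, ∀ᶠ n in atTop, ∀ i, |A i n| ≤ δ * B i n) :
    Tendsto (fun i => ∑' n, A i n) l (𝓝 0) := by
  rw [Metric.tendsto_nhds]
  intro η hη
  have hC' : 0 < |C| + 1 := by positivity
  obtain ⟨N, hN⟩ := eventually_atTop.1 (htail (η / 2 / (|C| + 1)) (by positivity))
  have hfin : Tendsto (fun i => ∑ n ∈ Finset.range N, A i n) l (𝓝 0) := by
    simpa using tendsto_finsetSum (Finset.range N) fun n _ => hlim n
  filter_upwards [Metric.tendsto_nhds.1 hfin (η / 2) (half_pos hη)] with i hi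
  rw [dist_zero_right, Real.norm_eq_abs] at hi ⊢
  rw [← (hA i).sum_add_tsum_nat_add N]
  have hBN := (summable_nat_add_iff N).2 (hB i)
  have htl : |∑' n, A i (n + N)| ≤ η / 2 := by
    have h1 : |∑' n, A i (n + N)| ≤ ∑' n, η / 2 / (|C| + 1) * B i (n + N) := by
      rw [← Real.norm_eq_abs]
      exact tsum_of_norm_bounded (hBN.mul_left _).hasSum fun n => hN _ (Nat.le_add_left _ _) i
    refine h1.trans ?_
    rw [tsum_mul_left]
    have h2 : ∑' n, B i (n + N) ≤ |C| + 1 := by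
      have h3 := (hB i).sum_add_tsum_nat_add N
      have h4 : 0 ≤ ∑ n ∈ Finset.range N, B i n := Finset.sum_nonneg fun n _ => hB0 i n
      linarith [hC i, le_abs_self C]
    calc η / 2 / (|C| + 1) * ∑' n, B i (n + N) ≤ η / 2 / (|C| + 1) * (|C| + 1) := by gcongr
      _ = η / 2 := by field_simp
  linarith [abs_add_le (∑ n ∈ Finset.range N, A i n) (∑' n, A i (n + N))]

namespace NakanoSumPlus

variable {𝕜 : Type v} [RCLike 𝕜] {e : NakanoExponents} {E : ℕ → Type w}
  [∀ n, NormedAddCommGroup (E n)] [∀ n, NormedSpace 𝕜 (E n)]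
  {H : Type w}

section NormedSpace

variable [NormedAddCommGroup H] [NormedSpace 𝕜 H] {I : Type*} {l : Filter I}
  {r : I → NakanoSumPlus 𝕜 e E H} {R : ℝ}

theorem tendsto_norm_coord_rpow_zero {n : ℕ} (hr : Tendsto (fun i => coord n (r i)) l (𝓝 0)) :
    Tendsto (fun i => ‖coord n (r i)‖ ^ e.p n) l (𝓝 0) := by
  have h := hr.norm.rpow_const (p := e.p n) (Or.inr (e.pos n).le)
  rwa [norm_zero, Real.zero_rpow (e.pos n).ne'] at h

/-- Along coordinatewise null families the modular is asymptotically quadratic. -/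
theorem tendsto_modular_smul_sub (hp : Tendsto e.p atTop (𝓝 2)) (hR : ∀ i, ‖r i‖ ≤ R)
    (hr : ∀ n, Tendsto (fun i => coord n (r i)) l (𝓝 0)) {t : ℝ} (ht : 0 < t) :
    Tendsto (fun i => modular ((t : 𝕜) • r i) - t ^ 2 * modular (r i)) l (𝓝 0) := by
  obtain ⟨C, -, hC⟩ := exists_modular_le ((nakanoModular 𝕜 e E).directSum (sqModular 𝕜 H)) R
  have hs : ∀ i n, ‖coord n ((t : 𝕜) • r i)‖ ^ e.p n = t ^ e.p n * ‖coord n (r i)‖ ^ e.p n :=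
    fun i n => by rw [map_smul, norm_ofReal_smul ht.le, Real.mul_rpow ht.le (norm_nonneg _)]
  have hsum : ∀ i, Summable fun n => t ^ e.p n * ‖coord n (r i)‖ ^ e.p n := fun i => by
    simpa only [hs] using summable ((t : 𝕜) • r i)
  have heq : ∀ i, modular ((t : 𝕜) • r i) - t ^ 2 * modular (r i)
      = ∑' n, (t ^ e.p n - t ^ 2) * ‖coord n (r i)‖ ^ e.p n := fun i => by
    simp only [sub_mul]
    rw [(hsum i).tsum_sub ((summable (r i)).mul_left _), tsum_mul_left, modular_eq, modular_eq,
      map_smul, norm_ofReal_smul ht.le]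
    simp only [hs]
    ring
  simp only [heq]
  -- The weights `t ^ p n - t ^ 2` tend to zero as `p n → 2`, so the tail is small relative to the
  -- modular of `r i`.
  refine tendsto_tsum_zero_of_tail (B := fun i n => ‖coord n (r i)‖ ^ e.p n) (C := C)
    (fun i => ?_) (fun i => summable (r i)) (fun i n => by positivity) (fun i => ?_)
    (fun n => ?_) fun δ hδ => ?_
  · simp only [sub_mul]
    exact (hsum i).sub ((summable (r i)).mul_left _)
  · have := hC _ (hR i)
    rw [modular_eq] at this
    nlinarith [norm_nonneg (snd (r i))]
  · simpa using (tendsto_norm_coord_rpow_zero (hr n)).const_mul (t ^ e.p n - t ^ 2)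
  · have h1 : Tendsto (fun n => t ^ e.p n - t ^ 2) atTop (𝓝 0) := by
      have : Tendsto (fun n => t ^ e.p n) atTop (𝓝 (t ^ 2)) := by
        rw [← Real.rpow_two]
        exact (Real.continuousAt_const_rpow ht.ne').tendsto.comp hp
      have h := Tendsto.sub_const this (t ^ 2)
      rwa [sub_self] at h
    filter_upwards [Metric.tendsto_nhds.1 h1 δ hδ] with n hn i
    rw [dist_zero_right, Real.norm_eq_abs] at hn
    rw [abs_mul, abs_of_nonneg (Real.rpow_nonneg (norm_nonneg (coord n (r i))) _)]
    gcongr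

/-- Scaling by `L⁻¹` brings the norms, hence the modulars, to one. By asymptotic quadraticity this
scaling divides the modular by `L ^ 2`. -/
theorem tendsto_modular_sq (hp : Tendsto e.p atTop (𝓝 2)) (hR : ∀ i, ‖r i‖ ≤ R)
    (hr : ∀ n, Tendsto (fun i => coord n (r i)) l (𝓝 0)) {L : ℝ} (hL0 : 0 ≤ L)
    (hL : Tendsto (fun i => ‖r i‖) l (𝓝 L)) :
    Tendsto (fun i => modular (r i)) l (𝓝 (L ^ 2)) := by
  rcases hL0.eq_or_lt with h0 | h0
  · subst h0
    simpa using tendsto_modular_zero hL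
  have h1 : Tendsto (fun i => ‖((L⁻¹ : ℝ) : 𝕜) • r i‖) l (𝓝 1) := by
    simp only [norm_ofReal_smul (inv_nonneg.2 hL0)]
    simpa [h0.ne'] using hL.const_mul L⁻¹
  have h2 := (tendsto_modular_one h1).sub (tendsto_modular_smul_sub hp hR hr (inv_pos.2 h0))
  have h3 := h2.const_mul (L ^ 2)
  rw [sub_zero, mul_one] at h3
  refine h3.congr fun i => ?_
  field_simp
  ring

/-- The modular is asymptotically additive along coordinatewise null families. -/
theorem tendsto_modular_add_sub (hR : ∀ i, ‖r i‖ ≤ R)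
    (hr : ∀ n, Tendsto (fun i => coord n (r i)) l (𝓝 0)) (x : NakanoSumPlus 𝕜 e E H)
    (hsnd : Tendsto (fun i => ‖snd x + snd (r i)‖ ^ 2 - ‖snd (r i)‖ ^ 2) l (𝓝 (‖snd x‖ ^ 2))) :
    Tendsto (fun i => modular (x + r i) - modular (r i)) l (𝓝 (modular x)) := by
  -- For a truncation of `x` only finitely many coordinates are affected. The component of `r i` in
  -- `H` need not be small; `hsnd` takes care of it, and it holds when `snd x = 0` or when the cross
  -- terms vanish in the limit.
  have hfin : ∀ N, Tendsto (fun i => modular (trunc N x + r i) - modular (r i)) l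
      (𝓝 (modular (trunc N x))) := fun N => by
    have h1 : ∀ i, modular (trunc N x + r i) - modular (r i)
        = ∑ n ∈ Finset.range N, (‖coord n x + coord n (r i)‖ ^ e.p n - ‖coord n (r i)‖ ^ e.p n)
          + (‖snd x + snd (r i)‖ ^ 2 - ‖snd (r i)‖ ^ 2) := fun i => by
      rw [modular_eq, modular_eq, ← (summable (trunc N x + r i)).sum_add_tsum_nat_add N,
        ← (summable (r i)).sum_add_tsum_nat_add N, Finset.sum_sub_distrib]
      have h2 : ∑ n ∈ Finset.range N, ‖coord n (trunc N x + r i)‖ ^ e.p n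
          = ∑ n ∈ Finset.range N, ‖coord n x + coord n (r i)‖ ^ e.p n := by
        refine Finset.sum_congr rfl fun n hn => ?_
        rw [map_add, coord_trunc, if_pos (Finset.mem_range.1 hn)]
      have h3 : ∀ n, coord (n + N) (trunc N x + r i) = coord (n + N) (r i) := fun n => by
        rw [map_add, coord_trunc, if_neg (by omega), zero_add]
      rw [h2]
      simp only [h3, map_add snd, snd_trunc]
      ring
    simp only [h1]
    rw [modular_eq_sum (trunc N x) (Finset.range N) fun n hn => by
      rw [coord_trunc, if_neg (by simpa using hn)], snd_trunc]
    refine Tendsto.add (tendsto_finsetSum _ fun n hn => ?_) hsnd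
    rw [coord_trunc, if_pos (Finset.mem_range.1 hn)]
    have h4 := ((hr n).const_add (coord n x)).norm.rpow_const (p := e.p n) (Or.inr (e.pos n).le)
    simpa using h4.sub (tendsto_norm_coord_rpow_zero (hr n))
  -- The passage from `trunc N x` to `x` is uniform in `i`, as the modular is uniformly continuous
  -- on bounded sets.
  rw [Metric.tendsto_nhds]
  intro ε hε
  obtain ⟨δ, hδ, hmod⟩ := exists_modular_sub_le
    ((nakanoModular 𝕜 e E).directSum (sqModular 𝕜 H)) (‖x‖ + 1 + |R|) (ε := ε / 3) (by positivity)
  have hN := Metric.tendsto_nhds.1 (tendsto_trunc x) (min δ 1) (by positivity)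
  obtain ⟨N, hN⟩ := hN.exists
  rw [dist_eq_norm] at hN
  have hxN : ‖trunc N x‖ ≤ ‖x‖ + 1 := by
    have := norm_sub_norm_le (trunc N x) x
    linarith [hN.le.trans (min_le_right δ 1)]
  have hNδ : ‖trunc N x - x‖ ≤ δ := hN.le.trans (min_le_left _ _)
  have hR0 := abs_nonneg R
  filter_upwards [Metric.tendsto_nhds.1 (hfin N) (ε / 3) (by positivity)] with i hi
  rw [Real.dist_eq] at hi ⊢
  have hri : ‖r i‖ ≤ |R| := (hR i).trans (le_abs_self R)
  have h1 := hmod (x + r i) (trunc N x + r i)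
    ((norm_add_le _ _).trans (by linarith)) ((norm_add_le _ _).trans (by linarith))
    (by simpa using hNδ)
  have h2 := hmod x (trunc N x) (by linarith) (by linarith) hNδ
  rw [abs_lt] at hi ⊢
  rw [abs_le] at h1 h2
  constructor <;> linarith

variable (e) in
-- It bounds the norm of a sum of `k` disjoint unit vectors by about `k ^ (1 / q)`. For `q > 1` this
-- is too small for a functional that is bounded below on all of them.
theorem modular_smul_sum_single_le (F : Finset ℕ) (v : ∀ n, E n) (hv : ∀ n ∈ F, ‖v n‖ = 1)
    {q t : ℝ} (ht0 : 0 < t) (ht1 : t ≤ 1) (hF : ∀ n ∈ F, q ≤ e.p n) :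
    modular ((t : 𝕜) • ∑ n ∈ F, (single n (v n) : NakanoSumPlus 𝕜 e E H)) ≤ F.card * t ^ q := by
  have hcoord : ∀ m, coord m (∑ n ∈ F, (single n (v n) : NakanoSumPlus 𝕜 e E H))
      = if m ∈ F then v m else 0 := fun m => by
    rw [map_sum]
    split_ifs with hm
    · rw [Finset.sum_eq_single_of_mem m hm fun n _ hnm => coord_single_of_ne hnm.symm _,
        coord_single_same]
    · exact Finset.sum_eq_zero fun n hn => coord_single_of_ne (by rintro rfl; exact hm hn) _
  rw [modular_eq_sum _ F fun n hn => by rw [map_smul, hcoord, if_neg hn, smul_zero]]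
  have hsnd : snd ((t : 𝕜) • ∑ n ∈ F, (single n (v n) : NakanoSumPlus 𝕜 e E H)) = 0 := by
    simp [map_sum]
  rw [hsnd, norm_zero, zero_pow two_ne_zero, add_zero, ← nsmul_eq_mul]
  refine Finset.sum_le_card_nsmul _ _ _ fun n hn => ?_
  rw [map_smul, hcoord, if_pos hn, norm_ofReal_smul ht0.le, hv n hn, mul_one]
  exact Real.rpow_le_rpow_of_exponent_ge ht0 ht1 (hF n hn)

/-- Unit vectors with disjoint supports tend weakly to zero. -/
theorem tendsto_apply_single_zero (hp : Tendsto e.p atTop (𝓝 2)) (u : ∀ n, E n)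
    (hu : ∀ᶠ n in atTop, ‖u n‖ = 1) (φ : NakanoSumPlus 𝕜 e E H →L[𝕜] 𝕜) :
    Tendsto (fun n => φ (single n (u n))) atTop (𝓝 0) := by
  by_contra hcon
  rw [Metric.tendsto_nhds] at hcon
  push Not at hcon
  obtain ⟨ε, hε, hfreq⟩ := hcon
  have hfreq' := hfreq.and_eventually (hu.and (hp.eventually (le_mem_nhds (show (3 / 2 : ℝ) < 2 by
    norm_num))))
  have hinf := Nat.frequently_atTop_iff_infinite.1 hfreq'
  obtain ⟨k, hk⟩ := exists_nat_gt (‖φ‖ / ε)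
  have hk0 : (0 : ℝ) < k := lt_of_le_of_lt (by positivity) hk
  have hk1 : (1 : ℝ) ≤ k := by exact_mod_cast (by exact_mod_cast hk0 : 0 < k)
  -- The sum `z` of `k ^ 3` such vectors, rotated so that `φ` adds up without cancellation, has `‖φ
  -- z‖ ≥ k ^ 3 * ε`. On the other hand `‖z‖ ≤ k ^ 2`, because `k ^ 3 * (k ^ 2)⁻¹ ^ (3 / 2) = 1`.
  -- This contradicts `‖φ‖ < k * ε`.
  obtain ⟨F, hFS, hFc⟩ := hinf.exists_subset_card_eq (k ^ 3)
  have hF : ∀ n ∈ F, ε ≤ ‖φ (single n (u n))‖ ∧ ‖u n‖ = 1 ∧ 3 / 2 ≤ e.p n := fun n hn => by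
    have h := hFS hn
    simpa using h
  choose! c hc1 hc2 using fun n => RCLike.exists_norm_eq_mul_self (φ (single n (u n)))
  set z : NakanoSumPlus 𝕜 e E H := ∑ n ∈ F, single n (c n • u n) with hz
  have hφz : φ z = ((∑ n ∈ F, ‖φ (single n (u n))‖ : ℝ) : 𝕜) := by
    rw [hz, map_sum, RCLike.ofReal_sum]
    refine Finset.sum_congr rfl fun n _ => ?_
    rw [map_smul, map_smul, hc2, smul_eq_mul]
  have h1 : (k : ℝ) ^ 3 * ε ≤ ‖φ z‖ := by
    rw [hφz, RCLike.norm_ofReal]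
    refine le_trans ?_ (le_abs_self _)
    have := Finset.card_nsmul_le_sum F (fun n => ‖φ (single n (u n))‖) ε fun n hn => (hF n hn).1
    rw [hFc, nsmul_eq_mul] at this
    exact_mod_cast this
  have h2 : ‖z‖ ≤ (k : ℝ) ^ 2 := by
    refine norm_le_of_modular_le z (by positivity) ?_
    refine (modular_smul_sum_single_le e F (fun n => c n • u n)
      (fun n hn => by rw [norm_smul, hc1, (hF n hn).2.1, one_mul]) (q := 3 / 2) (by positivity)
      (inv_le_one_of_one_le₀ (one_le_pow₀ hk1)) fun n hn => (hF n hn).2.2).trans ?_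
    rw [hFc, ← inv_pow, ← Real.rpow_natCast, ← Real.rpow_mul (by positivity)]
    norm_num
    rw [mul_inv_cancel₀ (by positivity)]
  have h3 := φ.le_opNorm z
  rw [div_lt_iff₀ hε] at hk
  have h4 : ‖φ‖ * ‖z‖ ≤ ‖φ‖ * (k : ℝ) ^ 2 := by gcongr
  have h5 : (k : ℝ) ^ 2 * ‖φ‖ < k ^ 2 * (k * ε) := by gcongr
  nlinarith

theorem tendsto_apply_single_zero_of_finiteDimensional (hp : Tendsto e.p atTop (𝓝 2))
    (u : ∀ n, E n) (hu : ∀ᶠ n in atTop, ‖u n‖ = 1) {F : Type*} [NormedAddCommGroup F]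
    [NormedSpace 𝕜 F] [FiniteDimensional 𝕜 F] (φ : NakanoSumPlus 𝕜 e E H →L[𝕜] F) :
    Tendsto (fun n => φ (single n (u n))) atTop (𝓝 0) := by
  set b := (Module.finBasis 𝕜 F).equivFunL
  have h : Tendsto (fun n => b (φ (single n (u n)))) atTop (𝓝 0) := by
    rw [tendsto_pi_nhds]
    intro i
    exact tendsto_apply_single_zero hp u hu
      ((ContinuousLinearMap.proj (R := 𝕜) (φ := fun _ => 𝕜) i).comp
        ((b : F →L[𝕜] Fin (Module.finrank 𝕜 F) → 𝕜).comp φ))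
  simpa [Function.comp_def] using (b.symm.continuous.tendsto 0).comp h

end NormedSpace

/-! ### The asymptotic parallelogram inequality. -/

section InnerProductSpace

variable [NormedAddCommGroup H] [InnerProductSpace 𝕜 H] {I : Type*} {l : Filter I}

/-- Coordinatewise null families satisfy one half of the parallelogram identity in the limit. -/
theorem sq_add_sq_le_of_tendsto [l.NeBot] (hp : Tendsto e.p atTop (𝓝 2))
    (hE : Tendsto (fun n => jordanVonNeumann (E n)) atTop (𝓝 1))
    {r s : I → NakanoSumPlus 𝕜 e E H} {R : ℝ} (hRr : ∀ i, ‖r i‖ ≤ R) (hRs : ∀ i, ‖s i‖ ≤ R)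
    (hr : ∀ n, Tendsto (fun i => coord n (r i)) l (𝓝 0))
    (hs : ∀ n, Tendsto (fun i => coord n (s i)) l (𝓝 0)) {a b c d : ℝ}
    (ha : Tendsto (fun i => ‖r i‖) l (𝓝 a)) (hb : Tendsto (fun i => ‖s i‖) l (𝓝 b))
    (hc : Tendsto (fun i => ‖r i + s i‖) l (𝓝 c)) (hd : Tendsto (fun i => ‖r i - s i‖) l (𝓝 d)) :
    c ^ 2 + d ^ 2 ≤ 2 * (a ^ 2 + b ^ 2) := by
  have nn : ∀ {f : I → ℝ} {x : ℝ}, (∀ i, 0 ≤ f i) → Tendsto f l (𝓝 x) → 0 ≤ x :=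
    fun hf hx => ge_of_tendsto' hx hf
  have hradd : ∀ n, Tendsto (fun i => coord n (r i + s i)) l (𝓝 0) := fun n => by
    simpa using (hr n).add (hs n)
  have hrsub : ∀ n, Tendsto (fun i => coord n (r i - s i)) l (𝓝 0) := fun n => by
    simpa using (hr n).sub (hs n)
  have ha' := tendsto_modular_sq hp hRr hr (nn (fun i => norm_nonneg _) ha) ha
  have hb' := tendsto_modular_sq hp hRs hs (nn (fun i => norm_nonneg _) hb) hb
  have hc' := tendsto_modular_sq (R := R + R) hp (fun i => (norm_add_le _ _).trans
    (add_le_add (hRr i) (hRs i))) hradd (nn (fun i => norm_nonneg _) hc) hc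
  have hd' := tendsto_modular_sq (R := R + R) hp (fun i => (norm_sub_le _ _).trans
    (add_le_add (hRr i) (hRs i))) hrsub (nn (fun i => norm_nonneg _) hd) hd
  obtain ⟨C, -, hC⟩ := exists_modular_le ((nakanoModular 𝕜 e E).directSum (sqModular 𝕜 H)) R
  set B : I → ℕ → ℝ := fun i n => ‖coord n (r i)‖ ^ e.p n + ‖coord n (s i)‖ ^ e.p n with hB
  set D : I → ℕ → ℝ := fun i n => ‖coord n (r i + s i)‖ ^ e.p n + ‖coord n (r i - s i)‖ ^ e.p n
    with hD
  have hBs : ∀ i, Summable (B i) := fun i => (summable (r i)).add (summable (s i))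
  have hDs : ∀ i, Summable (D i) := fun i => (summable (r i + s i)).add (summable (r i - s i))
  have hB0 : ∀ i n, 0 ≤ B i n := fun i n => by positivity
  have hD0 : ∀ i n, 0 ≤ D i n := fun i n => by positivity
  -- The constant `a (E n)` controls `D - 2 * B` from above only, so its positive part is what can
  -- be made small in absolute value.
  set A : I → ℕ → ℝ := fun i n => max 0 (D i n - 2 * B i n) with hA
  have hAs : ∀ i, Summable (A i) := fun i =>
    (hDs i).of_nonneg_of_le (fun n => le_max_left _ _) fun n =>
      max_le (hD0 i n) (by linarith [hB0 i n])
  have hlim : Tendsto (fun i => ∑' n, A i n) l (𝓝 0) := by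
    refine tendsto_tsum_zero_of_tail (C := C + C) hAs hBs hB0 (fun i => ?_) (fun n => ?_)
      fun δ hδ => ?_
    · rw [(summable (r i)).tsum_add (summable (s i))]
      have h1 := hC _ (hRr i)
      have h2 := hC _ (hRs i)
      rw [modular_eq] at h1 h2
      nlinarith [norm_nonneg (snd (r i)), norm_nonneg (snd (s i))]
    · have h1 := (tendsto_norm_coord_rpow_zero (hr n)).add (tendsto_norm_coord_rpow_zero (hs n))
      have h2 := (tendsto_norm_coord_rpow_zero (hradd n)).add
        (tendsto_norm_coord_rpow_zero (hrsub n))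
      simpa [hA, hB, hD] using (tendsto_const_nhds (x := (0 : ℝ))).max (h2.sub (h1.const_mul 2))
    · filter_upwards [eventually_rpow_add_rpow_le 𝕜 hp hE hδ] with n hn i
      rw [abs_of_nonneg (le_max_left _ _)]
      refine max_le (mul_nonneg hδ.le (hB0 i n)) ?_
      have := hn (coord n (r i)) (coord n (s i))
      simpa only [hD, hB, map_add, map_sub] using this
  have hle : ∀ i, modular (r i + s i) + modular (r i - s i)
      ≤ 2 * (modular (r i) + modular (s i)) + ∑' n, A i n := fun i => by
    have h1 : ∑' n, D i n ≤ ∑' n, (2 * B i n + A i n) :=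
      (hDs i).tsum_le_tsum (fun n => by linarith [le_max_right 0 (D i n - 2 * B i n)])
        (((hBs i).mul_left 2).add (hAs i))
    rw [((hBs i).mul_left 2).tsum_add (hAs i), tsum_mul_left,
      (summable (r i)).tsum_add (summable (s i)),
      (summable (r i + s i)).tsum_add (summable (r i - s i))] at h1
    have h2 := parallelogram_law_with_norm 𝕜 (snd (r i)) (snd (s i))
    simp only [modular_eq, map_add snd, map_sub snd]
    nlinarith
  have h := le_of_tendsto_of_tendsto' (hc'.add hd') (((ha'.add hb').const_mul 2).add hlim) hle
  simpa using h

end InnerProductSpace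

end NakanoSumPlus

end

end NakanoSums

namespace NakanoSums

noncomputable section

/-! ## Ultrapowers -/

namespace Ultrapower

variable {𝕜 : Type v} [RCLike 𝕜] {I : Type w} {U : Ultrafilter I}
  {X : Type w} [NormedAddCommGroup X] [NormedSpace 𝕜 X]
  {Y : Type w} [NormedAddCommGroup Y] [NormedSpace 𝕜 Y]

/-- A bounded family as an element of `ℓ_∞`. -/
def ofBounded (f : I → X) (C : ℝ) (h : ∀ i, ‖f i‖ ≤ C) : lp (fun _ : I => X) ∞ :=
  ⟨f, memℓp_infty ⟨C, by rintro _ ⟨i, rfl⟩; exact h i⟩⟩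

@[simp] theorem ofBounded_apply (f : I → X) (C : ℝ) (h : ∀ i, ‖f i‖ ≤ C) (i : I) :
    ofBounded f C h i = f i := rfl

variable (𝕜 U) in
/-- The class of a bounded family in the ultrapower. -/
def mk : lp (fun _ : I => X) ∞ →ₗ[𝕜] Ultrapower 𝕜 U X := (nullFamilies 𝕜 U X).mkQ

theorem mk_surjective (z : Ultrapower 𝕜 U X) : ∃ x, mk 𝕜 U x = z :=
  (nullFamilies 𝕜 U X).mkQ_surjective z

theorem norm_apply_le (x : lp (fun _ : I => X) ∞) (i : I) : ‖x i‖ ≤ ‖x‖ :=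
  lp.norm_apply_le_norm ENNReal.top_ne_zero x i

theorem mk_eq_zero_iff (x : lp (fun _ : I => X) ∞) :
    mk 𝕜 U x = 0 ↔ Tendsto (fun i => ‖x i‖) U (𝓝 0) :=
  Submodule.Quotient.mk_eq_zero _

theorem mk_eq_mk_iff (x y : lp (fun _ : I => X) ∞) :
    mk 𝕜 U x = mk 𝕜 U y ↔ Tendsto (fun i => ‖x i - y i‖) U (𝓝 0) := by
  rw [← sub_eq_zero, ← map_sub, mk_eq_zero_iff]
  rfl

theorem _root_.Ultrafilter.exists_tendsto_of_norm_le {I : Type*} (U : Ultrafilter I) {F : Type*}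
    [NormedAddCommGroup F] [ProperSpace F] (f : I → F) {C : ℝ} (h : ∀ i, ‖f i‖ ≤ C) :
    ∃ a, Tendsto f U (𝓝 a) := by
  obtain ⟨a, -, ha⟩ := (isCompact_closedBall (0 : F) C).ultrafilter_le_nhds (U.map f)
    (le_principal_iff.2 (Filter.mem_map.2 (univ_mem' fun i => by simpa using h i)))
  exact ⟨a, ha⟩

/-- The norm of an ultrapower is the limit of the norms. -/
theorem tendsto_norm_mk (x : lp (fun _ : I => X) ∞) :
    Tendsto (fun i => ‖x i‖) U (𝓝 ‖mk 𝕜 U x‖) := by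
  obtain ⟨L, hL⟩ := U.exists_tendsto_of_norm_le (fun i => ‖x i‖) (C := ‖x‖)
    (fun i => by simpa using norm_apply_le x i)
  suffices h : ‖mk 𝕜 U x‖ = L by rwa [h]
  have hL0 : 0 ≤ L := ge_of_tendsto' hL fun i => norm_nonneg _
  refine le_antisymm (le_of_forall_pos_le_add fun ε hε => ?_)
    (le_of_forall_pos_le_add fun ε hε => ?_)
  · classical
    -- Terms of norm above `L + ε` occur outside a member of `U`; replacing them by zero keeps the
    -- class and gives a representative of supremum norm at most `L + ε`.
    set y : lp (fun _ : I => X) ∞ := ofBounded (fun i => if ‖x i‖ ≤ L + ε then x i else 0) (L + ε)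
      (fun i => by
        split_ifs with h
        · exact h
        · simpa using by linarith)
    have hy : mk 𝕜 U x = mk 𝕜 U y := by
      rw [mk_eq_mk_iff]
      refine tendsto_const_nhds.congr' ?_
      filter_upwards [hL.eventually (ge_mem_nhds (lt_add_of_pos_right L hε))] with i hi
      simp [y, hi]
    rw [hy]
    refine (Submodule.Quotient.norm_mk_le (nullFamilies 𝕜 U X) y).trans ?_
    refine lp.norm_le_of_forall_le (by linarith) fun i => ?_
    rw [ofBounded_apply]
    split_ifs with h
    · exact h
    · simpa using by linarith
  · obtain ⟨m, hm, hlt⟩ : ∃ m, mk 𝕜 U m = mk 𝕜 U x ∧ ‖m‖ < ‖mk 𝕜 U x‖ + ε :=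
      Submodule.Quotient.norm_mk_lt (S := nullFamilies 𝕜 U X) _ hε
    have hm' := hm.symm
    rw [mk_eq_mk_iff] at hm'
    refine le_trans ?_ hlt.le
    have h1 : Tendsto (fun i => ‖x i - m i‖ + ‖m‖) U (𝓝 (0 + ‖m‖)) := hm'.add_const _
    rw [zero_add] at h1
    refine le_of_tendsto_of_tendsto' hL h1 fun i => ?_
    have h2 := norm_add_le (x i - m i) (m i)
    rw [sub_add_cancel] at h2
    have h3 := norm_apply_le m i
    linarith

variable (𝕜 I X) in
/-- The constant families. -/
def constFamily : X →ₗ[𝕜] lp (fun _ : I => X) ∞ where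
  toFun x := ofBounded (fun _ => x) ‖x‖ fun _ => le_rfl
  map_add' _ _ := lp.ext rfl
  map_smul' _ _ := lp.ext rfl

@[simp] theorem constFamily_apply (x : X) (i : I) : constFamily 𝕜 I X x i = x := rfl

variable (𝕜 U X) in
/-- The diagonal embedding. -/
def diag : X →ₗᵢ[𝕜] Ultrapower 𝕜 U X where
  toLinearMap := mk 𝕜 U ∘ₗ constFamily 𝕜 I X
  norm_map' x := tendsto_nhds_unique (tendsto_norm_mk (𝕜 := 𝕜) (U := U) (constFamily 𝕜 I X x))
    tendsto_const_nhds

theorem diag_apply (x : X) : diag 𝕜 U X x = mk 𝕜 U (constFamily 𝕜 I X x) := rfl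

/-- The family of images of a bounded family under a linear isometry. -/
def mapFamily (f : X →ₗᵢ[𝕜] Y) : lp (fun _ : I => X) ∞ →ₗ[𝕜] lp (fun _ : I => Y) ∞ where
  toFun x := ofBounded (fun i => f (x i)) ‖x‖ fun i => by
    rw [f.norm_map]; exact norm_apply_le x i
  map_add' x y := lp.ext (funext fun i => by simp)
  map_smul' c x := lp.ext (funext fun i => by simp)

@[simp] theorem mapFamily_apply (f : X →ₗᵢ[𝕜] Y) (x : lp (fun _ : I => X) ∞) (i : I) :
    mapFamily f x i = f (x i) := rfl

variable (U) in
/-- The linear isometry between ultrapowers induced by a linear isometry. -/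
def map (f : X →ₗᵢ[𝕜] Y) : Ultrapower 𝕜 U X →ₗᵢ[𝕜] Ultrapower 𝕜 U Y where
  toLinearMap := (nullFamilies 𝕜 U X).mapQ (nullFamilies 𝕜 U Y) (mapFamily f) fun x hx => by
    change Tendsto (fun i => ‖f (x i)‖) U (𝓝 0)
    simp only [f.norm_map]
    exact hx
  norm_map' z := by
    obtain ⟨x, rfl⟩ := mk_surjective z
    have h := tendsto_norm_mk (𝕜 := 𝕜) (U := U) (mapFamily f x)
    simp only [mapFamily_apply, f.norm_map] at h
    exact tendsto_nhds_unique h (tendsto_norm_mk x)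

theorem map_mk (f : X →ₗᵢ[𝕜] Y) (x : lp (fun _ : I => X) ∞) :
    map U f (mk 𝕜 U x) = mk 𝕜 U (mapFamily f x) := rfl

variable (U) in
/-- The isometry between ultrapowers induced by a surjective linear isometry. -/
def mapEquiv (f : X ≃ₗᵢ[𝕜] Y) : Ultrapower 𝕜 U X ≃ₗᵢ[𝕜] Ultrapower 𝕜 U Y :=
  LinearIsometryEquiv.ofSurjective (map U f.toLinearIsometry) fun z => by
    obtain ⟨y, rfl⟩ := mk_surjective z
    refine ⟨mk 𝕜 U (mapFamily f.symm.toLinearIsometry y), ?_⟩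
    rw [map_mk]
    exact congrArg _ (lp.ext (funext fun i => by simp))

end Ultrapower

end

end NakanoSums

namespace NakanoSums

noncomputable section

open ModularSpace

/-! ## Ultrapowers of modular direct sums -/

namespace NakanoSumPlus

/-! ### Splitting an ultrapower into coordinatewise limits and coordinatewise null families. -/

section Tail

variable {𝕜 : Type v} [RCLike 𝕜] {e : NakanoExponents} {E : ℕ → Type w}
  [∀ n, NormedAddCommGroup (E n)] [∀ n, NormedSpace 𝕜 (E n)]
  {H : Type w} [NormedAddCommGroup H] [NormedSpace 𝕜 H] {I : Type w} {U : Ultrafilter I}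
  {W : Type w} [NormedAddCommGroup W] [NormedSpace 𝕜 W]
  {q : lp (fun _ : I => NakanoSumPlus 𝕜 e E H) ∞ →ₗ[𝕜] W}

/-- Coordinate limits depend on the class only. Here and below `q` stands for the quotient map of
the ultrapower, which enters only through the limit formula `hn` for the norm and through
surjectivity. -/
theorem tendsto_coord_of_eq (hn : ∀ x, Tendsto (fun i => ‖x i‖) U (𝓝 ‖q x‖))
    {x y : lp (fun _ : I => NakanoSumPlus 𝕜 e E H) ∞} (h : q x = q y) {n : ℕ} {a : E n}
    (hx : Tendsto (fun i => coord n (x i)) U (𝓝 a)) :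
    Tendsto (fun i => coord n (y i)) U (𝓝 a) := by
  have h0 : Tendsto (fun i => ‖x i - y i‖) U (𝓝 0) := by
    have := hn (x - y)
    rwa [map_sub, h, sub_self, norm_zero] at this
  refine tendsto_of_tendsto_of_dist hx (squeeze_zero (fun i => dist_nonneg) (fun i => ?_) h0)
  rw [dist_eq_norm, ← map_sub]
  exact norm_coord_le _ n

variable (U q) in
/-- The subspace formed by the classes of the coordinatewise null families. -/
def tail : Submodule 𝕜 W where
  carrier := {z | ∃ x, q x = z ∧ ∀ n, Tendsto (fun i => coord n (x i)) U (𝓝 0)}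
  zero_mem' := ⟨0, map_zero _, fun n => by simp⟩
  add_mem' := by
    rintro _ _ ⟨x, rfl, hx⟩ ⟨y, rfl, hy⟩
    exact ⟨x + y, map_add _ _ _, fun n => by simpa using (hx n).add (hy n)⟩
  smul_mem' := by
    rintro c _ ⟨x, rfl, hx⟩
    exact ⟨c • x, map_smul _ _ _, fun n => by simpa using (hx n).const_smul c⟩

theorem mem_tail_iff (hn : ∀ x, Tendsto (fun i => ‖x i‖) U (𝓝 ‖q x‖))
    (x : lp (fun _ : I => NakanoSumPlus 𝕜 e E H) ∞) :
    q x ∈ tail U q ↔ ∀ n, Tendsto (fun i => coord n (x i)) U (𝓝 0) :=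
  ⟨fun ⟨_, hyx, hy⟩ n => tendsto_coord_of_eq hn hyx (hy n), fun h => ⟨x, rfl, h⟩⟩

theorem isClosed_tail (hn : ∀ x, Tendsto (fun i => ‖x i‖) U (𝓝 ‖q x‖))
    (hq : Function.Surjective q) : IsClosed (tail U q : Set W) := by
  refine isClosed_of_closure_subset fun z hz => ?_
  obtain ⟨x, rfl⟩ := hq z
  refine (mem_tail_iff hn x).2 fun n => ?_
  rw [tendsto_zero_iff_norm_tendsto_zero, Metric.tendsto_nhds]
  intro ε hε
  obtain ⟨_, ⟨y, rfl, hy⟩, hxy⟩ := Metric.mem_closure_iff.1 hz (ε / 2) (half_pos hε)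
  rw [dist_eq_norm, ← map_sub] at hxy
  filter_upwards [(hn (x - y)).eventually (gt_mem_nhds hxy),
    Metric.tendsto_nhds.1 (hy n) (ε / 2) (half_pos hε)] with i hi hi'
  rw [dist_zero_right] at hi' ⊢
  rw [norm_norm]
  have h1 : ‖coord n (x i) - coord n (y i)‖ ≤ ‖x i - y i‖ := by
    rw [← map_sub]
    exact norm_coord_le _ n
  have h2 : ‖coord n (x i)‖ ≤ ‖coord n (x i) - coord n (y i)‖ + ‖coord n (y i)‖ := by
    simpa using norm_add_le (coord n (x i) - coord n (y i)) (coord n (y i))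
  have h3 : ‖x i - y i‖ < ε / 2 := hi
  linarith

variable (U q) in
/-- The canonical map from a modular direct sum into the ultrapower. -/
def ofTail : NakanoSumPlus 𝕜 e E (tail U q) →ₗ[𝕜] W :=
  q ∘ₗ Ultrapower.constFamily 𝕜 I (NakanoSumPlus 𝕜 e E H) ∘ₗ seqPart + (tail U q).subtype ∘ₗ snd

theorem ofTail_apply (z : NakanoSumPlus 𝕜 e E (tail U q)) :
    ofTail U q z
      = q (Ultrapower.constFamily 𝕜 I (NakanoSumPlus 𝕜 e E H) (seqPart z)) + ((snd z : tail U q) : W) := rfl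

/-- Families in the tail have a free component in `H`, whereas `seqPart z` has none, so asymptotic
additivity applies with a trivial condition on `H`. For a unit vector `z` and a representative `r`
of its tail component, the modulars of `seqPart z + r i` tend to `modular (seqPart z) + ‖snd z‖ ^ 2
= 1`. -/
theorem norm_ofTail (hp : Tendsto e.p atTop (𝓝 2))
    (hn : ∀ x, Tendsto (fun i => ‖x i‖) U (𝓝 ‖q x‖))
    (z : NakanoSumPlus 𝕜 e E (tail U q)) : ‖ofTail U q z‖ = ‖z‖ := by
  refine (ofTail U q).norm_map_of_norm_eq_one (fun z hz => ?_) z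
  obtain ⟨r, hrz, hr⟩ := (snd z).2
  have hR : ∀ i, ‖r i‖ ≤ ‖r‖ := Ultrapower.norm_apply_le r
  have hz1 := (modular_eq_one_iff z).2 hz
  have hrn : Tendsto (fun i => ‖r i‖) U (𝓝 ‖snd z‖) := by
    have h := hn r
    rwa [hrz] at h
  have h1 := tendsto_modular_sq hp hR hr (norm_nonneg (snd z)) hrn
  have h2 := tendsto_modular_add_sub hR hr (seqPart z : NakanoSumPlus 𝕜 e E H) (by simp)
  have h3 := h2.add h1
  have h4 : modular (seqPart z : NakanoSumPlus 𝕜 e E H) + ‖snd z‖ ^ 2 = 1 := by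
    rw [← hz1, modular_eq (seqPart z : NakanoSumPlus 𝕜 e E H), modular_eq z]
    simp
  rw [h4] at h3
  simp only [sub_add_cancel] at h3
  rw [ofTail_apply, ← hrz, ← map_add]
  exact tendsto_nhds_unique (hn _) (tendsto_norm_one h3)

/-- Bounded sets in `E n` are relatively compact, so coordinate limits exist; lower semicontinuity
makes them an element of the Nakano sum. What remains after subtracting it, including everything in
`H`, is in the tail. -/
theorem ofTail_surjective [∀ n, FiniteDimensional 𝕜 (E n)]
    (hn : ∀ x, Tendsto (fun i => ‖x i‖) U (𝓝 ‖q x‖)) (hq : Function.Surjective q) :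
    Function.Surjective (ofTail U q) := by
  intro z
  obtain ⟨r, rfl⟩ := hq z
  have hlim : ∀ n, ∃ a, Tendsto (fun i => coord n (r i)) U (𝓝 a) := fun n =>
    have := FiniteDimensional.proper_rclike 𝕜 (E n)
    U.exists_tendsto_of_norm_le _ fun i =>
      (norm_coord_le _ n).trans (Ultrapower.norm_apply_le r i)
  choose a ha using hlim
  obtain ⟨C, -, hC⟩ :=
    exists_modular_le ((nakanoModular 𝕜 e E).directSum (sqModular 𝕜 H)) ‖r‖
  have hs : Summable fun n => ‖a n‖ ^ e.p n := summable_of_tendsto_coord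
    (Eventually.of_forall fun i => hC _ (Ultrapower.norm_apply_le r i)) ha
  set x : NakanoSumPlus 𝕜 e E H := ofSeq a hs 0 with hx
  have hmem : q (r - Ultrapower.constFamily 𝕜 I _ x) ∈ tail U q :=
    (mem_tail_iff hn _).2 fun n => by simpa [hx] using (ha n).sub_const (a n)
  refine ⟨ofSeq a hs ⟨_, hmem⟩, ?_⟩
  rw [ofTail_apply, snd_ofSeq, ← map_add]
  exact congrArg q (add_sub_cancel _ _)

end Tail

variable {𝕜 : Type v} [RCLike 𝕜] {e : NakanoExponents} {E : ℕ → Type w}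
  [∀ n, NormedAddCommGroup (E n)] [∀ n, NormedSpace 𝕜 (E n)]
  {H : Type w} [NormedAddCommGroup H] [InnerProductSpace 𝕜 H] {I : Type w} {U : Ultrafilter I}
  {W : Type w} [NormedAddCommGroup W] [NormedSpace 𝕜 W]
  {q : lp (fun _ : I => NakanoSumPlus 𝕜 e E H) ∞ →ₗ[𝕜] W}

/-- The asymptotic estimate yields only `≤`. Applied to `x + y` and `x - y`, it yields the reverse
inequality. -/
theorem tail_parallelogram (hp : Tendsto e.p atTop (𝓝 2))
    (hE : Tendsto (fun n => jordanVonNeumann (E n)) atTop (𝓝 1))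
    (hn : ∀ x, Tendsto (fun i => ‖x i‖) U (𝓝 ‖q x‖)) (x y : tail U q) :
    ‖x + y‖ * ‖x + y‖ + ‖x - y‖ * ‖x - y‖ = 2 * (‖x‖ * ‖x‖ + ‖y‖ * ‖y‖) := by
  have key : ∀ x y : tail U q, ‖x + y‖ ^ 2 + ‖x - y‖ ^ 2 ≤ 2 * (‖x‖ ^ 2 + ‖y‖ ^ 2) := by
    rintro ⟨_, r, rfl, hr⟩ ⟨_, s, rfl, hs⟩
    refine sq_add_sq_le_of_tendsto (l := U) hp hE
      (fun i => (Ultrapower.norm_apply_le r i).trans (le_max_left _ ‖s‖))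
      (fun i => (Ultrapower.norm_apply_le s i).trans (le_max_right _ _)) hr hs
      (hn r) (hn s) ?_ ?_
    · have h := hn (r + s)
      rwa [map_add] at h
    · have h := hn (r - s)
      rwa [map_sub] at h
  have h1 := key x y
  have h2 := key (x + y) (x - y)
  have h3 : x + y + (x - y) = (2 : 𝕜) • x := by module
  have h4 : x + y - (x - y) = (2 : 𝕜) • y := by module
  rw [h3, h4, norm_smul, norm_smul, RCLike.norm_ofNat] at h2
  nlinarith

theorem exists_equiv_of_surjective [∀ n, FiniteDimensional 𝕜 (E n)] [CompleteSpace W]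
    (hp : Tendsto e.p atTop (𝓝 2)) (hE : Tendsto (fun n => jordanVonNeumann (E n)) atTop (𝓝 1))
    (hn : ∀ x, Tendsto (fun i => ‖x i‖) U (𝓝 ‖q x‖)) (hq : Function.Surjective q) :
    ∃ (K : Type w) (_ : NormedAddCommGroup K) (_ : InnerProductSpace 𝕜 K) (_ : CompleteSpace K),
      Nonempty (W ≃ₗᵢ[𝕜] NakanoSumPlus 𝕜 e E K) :=
  ⟨tail U q, inferInstance, InnerProductSpace.ofNorm 𝕜 (tail_parallelogram hp hE hn),
    (isClosed_tail hn hq).completeSpace_coe,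
    ⟨(LinearIsometryEquiv.ofSurjective ⟨ofTail U q, norm_ofTail hp hn⟩
      (ofTail_surjective hn hq)).symm⟩⟩

/-- The ultrapower of a modular direct sum is again a modular direct sum. -/
theorem exists_ultrapower_equiv [CompleteSpace H] [∀ n, FiniteDimensional 𝕜 (E n)]
    (hp : Tendsto e.p atTop (𝓝 2)) (hE : Tendsto (fun n => jordanVonNeumann (E n)) atTop (𝓝 1))
    (U : Ultrafilter I) :
    ∃ (K : Type w) (_ : NormedAddCommGroup K) (_ : InnerProductSpace 𝕜 K) (_ : CompleteSpace K),
      Nonempty (Ultrapower 𝕜 U (NakanoSumPlus 𝕜 e E H) ≃ₗᵢ[𝕜] NakanoSumPlus 𝕜 e E K) := by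
  have : ∀ n, CompleteSpace (E n) := fun n => FiniteDimensional.complete 𝕜 (E n)
  exact exists_equiv_of_surjective hp hE Ultrapower.tendsto_norm_mk Ultrapower.mk_surjective

end NakanoSumPlus

end

end NakanoSums

namespace NakanoSums

noncomputable section

open ModularSpace

/-! ## Isometric embeddings between modular direct sums -/

namespace NakanoSumPlus

/-! ### Subspaces on which the modular is homogeneous. -/

section Level

variable {𝕜 : Type v} [RCLike 𝕜] {e : NakanoExponents} {E : ℕ → Type w}
  [∀ n, NormedAddCommGroup (E n)] [∀ n, NormedSpace 𝕜 (E n)]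
  {H : Type w} [NormedAddCommGroup H] [NormedSpace 𝕜 H]
  {K : Type w} [NormedAddCommGroup K] [NormedSpace 𝕜 K]

theorem norm_coord_smul_rpow (x : NakanoSumPlus 𝕜 e E H) {t : ℝ} (ht : 0 ≤ t) (n : ℕ) :
    ‖coord n ((t : 𝕜) • x)‖ ^ e.p n = t ^ e.p n * ‖coord n x‖ ^ e.p n := by
  rw [map_smul, norm_ofReal_smul ht, Real.mul_rpow ht (norm_nonneg _)]

theorem summable_smul (x : NakanoSumPlus 𝕜 e E H) {t : ℝ} (ht : 0 ≤ t) :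
    Summable fun n => t ^ e.p n * ‖coord n x‖ ^ e.p n := by
  simpa only [norm_coord_smul_rpow x ht] using summable ((t : 𝕜) • x)

theorem modular_smul (x : NakanoSumPlus 𝕜 e E H) {t : ℝ} (ht : 0 ≤ t) :
    modular ((t : 𝕜) • x) = ∑' n, t ^ e.p n * ‖coord n x‖ ^ e.p n + t ^ 2 * ‖snd x‖ ^ 2 := by
  rw [modular_eq, map_smul, norm_ofReal_smul ht, mul_pow]
  simp only [norm_coord_smul_rpow x ht]

variable (𝕜 e E H) in
/-- The subspace spanned by those `E m` whose exponent is the one of `E n`. -/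
def level (n : ℕ) : Submodule 𝕜 (NakanoSumPlus 𝕜 e E H) where
  carrier := {z | snd z = 0 ∧ ∀ m, e.p m ≠ e.p n → coord m z = 0}
  zero_mem' := ⟨map_zero _, fun _ _ => map_zero _⟩
  add_mem' := fun ⟨h1, h2⟩ ⟨h3, h4⟩ =>
    ⟨by rw [map_add, h1, h3, add_zero], fun m hm => by rw [map_add, h2 m hm, h4 m hm, add_zero]⟩
  smul_mem' := fun c _ ⟨h1, h2⟩ =>
    ⟨by rw [map_smul, h1, smul_zero], fun m hm => by rw [map_smul, h2 m hm, smul_zero]⟩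

theorem single_mem_level (n : ℕ) (v : E n) : single n v ∈ level 𝕜 e E H n :=
  ⟨snd_single n v, fun m hm => coord_single_of_ne (fun h => hm (by rw [h])) v⟩

theorem seqPart_mem_level {n : ℕ} {z : NakanoSumPlus 𝕜 e E K} (hz : z ∈ level 𝕜 e E K n) :
    seqPart z ∈ level 𝕜 e E H n :=
  ⟨snd_seqPart z, fun m hm => hz.2 m hm⟩

theorem modular_smul_of_mem_level {n : ℕ} {z : NakanoSumPlus 𝕜 e E H}
    (hz : z ∈ level 𝕜 e E H n) {t : ℝ} (ht : 0 ≤ t) :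
    modular ((t : 𝕜) • z) = t ^ e.p n * modular z := by
  rw [modular_smul z ht, modular_eq, hz.1, norm_zero, zero_pow two_ne_zero, mul_zero, add_zero,
    add_zero, ← tsum_mul_left]
  refine tsum_congr fun m => ?_
  by_cases hm : e.p m = e.p n
  · rw [hm]
  · rw [hz.2 m hm, norm_zero, Real.zero_rpow (e.pos m).ne', mul_zero, mul_zero]

/-- An exponent different from the limit `2` is attained only finitely often. -/
theorem finiteDimensional_level [∀ n, FiniteDimensional 𝕜 (E n)] (hp2 : ∀ n, e.p n ≠ 2)
    (hp : Tendsto e.p atTop (𝓝 2)) (n : ℕ) : FiniteDimensional 𝕜 (level 𝕜 e E H n) := by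
  have hfin : {m | e.p m = e.p n}.Finite := by
    have h := hp.eventually (isOpen_ne.mem_nhds (hp2 n).symm)
    rw [← Nat.cofinite_eq_atTop, eventually_cofinite] at h
    simpa using h
  have := hfin.to_subtype
  let f : level 𝕜 e E H n →ₗ[𝕜] ∀ m : {m | e.p m = e.p n}, E m :=
    LinearMap.pi fun m => coord m.1 ∘ₗ (level 𝕜 e E H n).subtype
  refine Module.Finite.of_injective f fun x y hxy => Subtype.ext (ext (fun m => ?_) ?_)
  · by_cases hm : e.p m = e.p n
    · exact congrFun hxy ⟨m, hm⟩
    · rw [x.2.2 m hm, y.2.2 m hm]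
  · rw [x.2.1, y.2.1]

/-- A level subspace is recognized by the growth of the modular along rays. -/
theorem mem_level_of_modular (hp2 : ∀ n, e.p n ≠ 2) {n : ℕ} (w : NakanoSumPlus 𝕜 e E H)
    (h2 : modular (((1 / 2 : ℝ) : 𝕜) • w) = (1 / 2) ^ e.p n * modular w)
    (h4 : modular (((1 / 4 : ℝ) : 𝕜) • w) = (1 / 4) ^ e.p n * modular w) :
    w ∈ level 𝕜 e E H n := by
  have hquarter : ∀ q : ℝ, (1 / 4 : ℝ) ^ q = ((1 / 2 : ℝ) ^ q) ^ 2 := fun q => by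
    rw [← Real.rpow_natCast, ← Real.rpow_mul (by norm_num), mul_comm, Real.rpow_mul (by norm_num)]
    norm_num
  set x : ℝ := (1 / 2) ^ e.p n with hx
  have hx0 : 0 < x := by positivity
  set y : ℕ → ℝ := fun m => (1 / 2) ^ e.p m with hy
  set a : ℕ → ℝ := fun m => ‖coord m w‖ ^ e.p m with ha
  have ha0 : ∀ m, 0 ≤ a m := fun m => by positivity
  have s1 : Summable a := summable w
  have s2 : Summable fun m => y m * a m := summable_smul w (by norm_num)
  have s4 : Summable fun m => y m ^ 2 * a m := by
    have := summable_smul w (t := 1 / 4) (by norm_num)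
    simpa only [hquarter] using this
  rw [modular_smul w (by norm_num)] at h2 h4
  simp only [hquarter] at h4
  rw [modular_eq] at h2 h4
  change ∑' m, y m * a m + _ = x * (∑' m, a m + _) at h2
  change ∑' m, y m ^ 2 * a m + _ = x ^ 2 * (∑' m, a m + _) at h4
  have s : Summable fun m => (x - y m) ^ 2 * a m := by
    refine (((s1.mul_left (x ^ 2)).sub (s2.mul_left (2 * x))).add s4).congr fun m => ?_
    ring
  have hsum : ∑' m, (x - y m) ^ 2 * a m
      = x ^ 2 * ∑' m, a m - 2 * x * ∑' m, y m * a m + ∑' m, y m ^ 2 * a m := by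
    rw [← tsum_mul_left, ← tsum_mul_left,
      ← (s1.mul_left (x ^ 2)).tsum_sub (s2.mul_left (2 * x)),
      ← ((s1.mul_left (x ^ 2)).sub (s2.mul_left (2 * x))).tsum_add s4]
    exact tsum_congr fun m => by ring
  -- The combination `x ^ 2 * Θ w - 2 * x * Θ (w / 2) + Θ (w / 4)` vanishes by hypothesis, and
  -- expanding it turns it into a sum of squares. So every component whose exponent differs from `p
  -- n` is zero, including the one in `H`, whose exponent is `2`.
  have hzero : ∑' m, (x - y m) ^ 2 * a m + (x - 1 / 4) ^ 2 * ‖snd w‖ ^ 2 = 0 := by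
    rw [hsum]
    linear_combination h4 - 2 * x * h2
  have hnn : 0 ≤ ∑' m, (x - y m) ^ 2 * a m := tsum_nonneg fun m => by positivity
  have hnn' : 0 ≤ (x - 1 / 4) ^ 2 * ‖snd w‖ ^ 2 := by positivity
  have hinj : ∀ q : ℝ, x = (1 / 2) ^ q → e.p n = q := fun q hq =>
    (Real.rpow_right_inj (by norm_num) (by norm_num)).1 hq
  constructor
  · have h : (x - 1 / 4) ^ 2 * ‖snd w‖ ^ 2 = 0 := by linarith
    rcases mul_eq_zero.1 h with h | h
    · refine absurd (hinj 2 ?_) (hp2 n)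
      have : x = 1 / 4 := by nlinarith [pow_eq_zero_iff two_ne_zero |>.1 h]
      rw [this, Real.rpow_two]
      norm_num
    · simpa using h
  · intro m hm
    have h : ∑' m, (x - y m) ^ 2 * a m = 0 := by linarith
    have h' := (s.hasSum_iff.2 h)
    rw [hasSum_zero_iff_of_nonneg fun m => mul_nonneg (sq_nonneg _) (ha0 m)] at h'
    have h'' : (x - y m) ^ 2 * a m = 0 := congrFun h' m
    rcases mul_eq_zero.1 h'' with h | h
    · exact absurd (hinj (e.p m) (sub_eq_zero.1 (pow_eq_zero_iff two_ne_zero |>.1 h))).symm hm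
    · exact norm_eq_zero.1 ((Real.rpow_eq_zero (norm_nonneg _) (e.pos m).ne').1 h)

end Level

/-! ### Rigidity of linear isometries between modular sums. -/

section Isometry

variable {𝕜 : Type v} [RCLike 𝕜] {e : NakanoExponents} {E : ℕ → Type w}
  [∀ n, NormedAddCommGroup (E n)] [∀ n, NormedSpace 𝕜 (E n)] [∀ n, FiniteDimensional 𝕜 (E n)]
  {H : Type w} [NormedAddCommGroup H] [InnerProductSpace 𝕜 H]
  {K : Type w} [NormedAddCommGroup K] [InnerProductSpace 𝕜 K]

/-- A linear isometry preserves the modular on the open unit ball. -/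
theorem modular_map (hp : Tendsto e.p atTop (𝓝 2))
    (hE : Tendsto (fun n => jordanVonNeumann (E n)) atTop (𝓝 1))
    (T : NakanoSumPlus 𝕜 e E H →ₗᵢ[𝕜] NakanoSumPlus 𝕜 e E K) (z : NakanoSumPlus 𝕜 e E H)
    (hz : modular z < 1) : modular (T z) = modular z := by
  -- Those `E n` without a unit vector, finitely many, receive the zero vector.
  obtain ⟨u, hu1, hu⟩ : ∃ u : ∀ n, E n, (∀ n, ‖u n‖ ≤ 1) ∧ ∀ᶠ n in atTop, ‖u n‖ = 1 := by
    have : ∀ n, ∃ v : E n, ‖v‖ ≤ 1 ∧ ((∃ w : E n, ‖w‖ = 1) → ‖v‖ = 1) := fun n => by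
      by_cases h : ∃ w : E n, ‖w‖ = 1
      · obtain ⟨w, hw⟩ := h
        exact ⟨w, hw.le, fun _ => hw⟩
      · exact ⟨0, by simp, fun h' => absurd h' h⟩
    choose u hu1 hu using this
    exact ⟨u, hu1, (eventually_exists_norm_eq_one 𝕜 hE).mono hu⟩
  have hz0 : 0 ≤ 1 - modular z := by linarith
  -- With this `s` the modular of `z + s u n` tends to `modular z + s ^ 2 = 1`, so its norm tends to
  -- one, which is a condition that `T` preserves.
  set s := √(1 - modular z) with hs
  have hs0 : 0 ≤ s := Real.sqrt_nonneg _
  have hs2 : s ^ 2 = 1 - modular z := Real.sq_sqrt hz0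
  set r : ℕ → NakanoSumPlus 𝕜 e E H := fun n => (s : 𝕜) • single n (u n) with hr
  have hrn : ∀ n, ‖r n‖ = s * ‖u n‖ := fun n => by
    simp only [hr]
    rw [norm_ofReal_smul hs0, norm_single]
  have hrs : ∀ n, ‖r n‖ ≤ s := fun n => by
    rw [hrn]
    exact mul_le_of_le_one_right hs0 (hu1 n)
  have hrlim : Tendsto (fun n => ‖r n‖) atTop (𝓝 s) := by
    refine tendsto_const_nhds.congr' ?_
    filter_upwards [hu] with n hn
    rw [hrn, hn, mul_one]
  have hrcoord : ∀ m, Tendsto (fun n => coord m (r n)) atTop (𝓝 0) := fun m => by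
    refine tendsto_const_nhds.congr' ?_
    filter_upwards [eventually_gt_atTop m] with n hn
    simp only [hr]
    rw [map_smul, coord_single_of_ne hn.ne, smul_zero]
  have h1 := (tendsto_modular_add_sub hrs hrcoord z (by simp [hr])).add
    (tendsto_modular_sq hp hrs hrcoord hs0 hrlim)
  rw [hs2, add_sub_cancel] at h1
  simp only [sub_add_cancel] at h1
  have h2 := tendsto_norm_one h1
  have h3 : Tendsto (fun n => ‖T z + T (r n)‖) atTop (𝓝 1) := by
    simpa only [← map_add, T.norm_map] using h2
  have h4 := tendsto_modular_one h3
  -- the images of the vectors `r n` are weakly null as well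
  have hTs : ∀ n, ‖T (r n)‖ ≤ s := fun n => by rw [T.norm_map]; exact hrs n
  have hTlim : Tendsto (fun n => ‖T (r n)‖) atTop (𝓝 s) := by simpa only [T.norm_map] using hrlim
  have hTcoord : ∀ m, Tendsto (fun n => coord m (T (r n))) atTop (𝓝 0) := fun m => by
    have h := tendsto_apply_single_zero_of_finiteDimensional hp u hu
      ((coordL 𝕜 e E K m).comp T.toContinuousLinearMap)
    have h' := h.const_smul (s : 𝕜)
    rw [smul_zero] at h'
    refine h'.congr fun n => ?_
    simp only [hr, map_smul]
    rfl
  -- The component of `T (r n)` in `K` need not become small, but its inner product with the fixed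
  -- vector `snd (T z)` does.
  have hTsnd : Tendsto (fun n => ‖snd (T z) + snd (T (r n))‖ ^ 2 - ‖snd (T (r n))‖ ^ 2) atTop
      (𝓝 (‖snd (T z)‖ ^ 2)) := by
    have h := tendsto_apply_single_zero hp u hu
      ((innerSL 𝕜 (snd (T z))).comp ((sndL 𝕜 e E K).comp T.toContinuousLinearMap))
    have h' : Tendsto (fun n => inner 𝕜 (snd (T z)) (snd (T (r n)))) atTop (𝓝 0) := by
      have h' := h.const_smul (s : 𝕜)
      rw [smul_zero] at h'
      refine h'.congr fun n => ?_
      simp only [hr, map_smul, inner_smul_right]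
      rfl
    have h'' := ((RCLike.continuous_re.tendsto (0 : 𝕜)).comp h').const_mul 2
    have h3 := h''.const_add (‖snd (T z)‖ ^ 2)
    simp only [map_zero, mul_zero, add_zero] at h3
    refine h3.congr fun n => ?_
    rw [norm_add_sq (𝕜 := 𝕜)]
    simp only [Function.comp_apply]
    ring
  have h5 := (tendsto_modular_add_sub hTs hTcoord (T z) hTsnd).add
    (tendsto_modular_sq hp hTs hTcoord hs0 hTlim)
  simp only [sub_add_cancel] at h5
  have h6 := tendsto_nhds_unique h5 h4
  linarith

/-- A multiple of `z` has modular below one, where `T` preserves the modular. Its image then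
inherits homogeneity of degree `p n` for factors in `[0, 1]`, and the factors `1 / 2` and `1 / 4`
suffice to recognize the level. -/
theorem map_mem_level (hp2 : ∀ n, e.p n ≠ 2) (hp : Tendsto e.p atTop (𝓝 2))
    (hE : Tendsto (fun n => jordanVonNeumann (E n)) atTop (𝓝 1))
    (T : NakanoSumPlus 𝕜 e E H →ₗᵢ[𝕜] NakanoSumPlus 𝕜 e E K) {n : ℕ}
    {z : NakanoSumPlus 𝕜 e E H} (hz : z ∈ level 𝕜 e E H n) : T z ∈ level 𝕜 e E K n := by
  have hm := modular_nonneg z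
  set t : ℝ := (1 + modular z)⁻¹ with ht
  have ht0 : 0 < t := by positivity
  have ht1 : t ≤ 1 := inv_le_one_of_one_le₀ (by linarith)
  have hlt : modular ((t : 𝕜) • z) < 1 := by
    refine (modular_smul_le z ht0.le ht1).trans_lt ?_
    rw [ht, inv_mul_lt_iff₀ (by linarith)]
    linarith
  have hmem : (t : 𝕜) • z ∈ level 𝕜 e E H n := Submodule.smul_mem _ _ hz
  have key : ∀ c : ℝ, 0 ≤ c → c ≤ 1 →
      modular ((c : 𝕜) • T ((t : 𝕜) • z)) = c ^ e.p n * modular (T ((t : 𝕜) • z)) := by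
    intro c hc0 hc1
    have hc : modular ((c : 𝕜) • ((t : 𝕜) • z)) < 1 :=
      (modular_smul_le _ hc0 hc1).trans_lt (by nlinarith [modular_nonneg ((t : 𝕜) • z)])
    rw [← map_smul, modular_map hp hE T _ hc, modular_map hp hE T _ hlt,
      modular_smul_of_mem_level hmem hc0]
  have h := mem_level_of_modular hp2 (T ((t : 𝕜) • z)) (key (1 / 2) (by norm_num) (by norm_num))
    (key (1 / 4) (by norm_num) (by norm_num))
  rw [map_smul] at h
  exact (Submodule.smul_mem_iff _ (RCLike.ofReal_ne_zero.2 ht0.ne')).1 h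

/-- A linear isometry maps the level subspaces onto the level subspaces. -/
theorem exists_map_eq_of_mem_level (hp2 : ∀ n, e.p n ≠ 2) (hp : Tendsto e.p atTop (𝓝 2))
    (hE : Tendsto (fun n => jordanVonNeumann (E n)) atTop (𝓝 1))
    (T : NakanoSumPlus 𝕜 e E H →ₗᵢ[𝕜] NakanoSumPlus 𝕜 e E K) {n : ℕ}
    {y : NakanoSumPlus 𝕜 e E K} (hy : y ∈ level 𝕜 e E K n) :
    ∃ z ∈ level 𝕜 e E H n, T z = y := by
  have := finiteDimensional_level (𝕜 := 𝕜) (E := E) (H := H) hp2 hp n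
  have hinj : ∀ {a b : NakanoSumPlus 𝕜 e E K}, a ∈ level 𝕜 e E K n → b ∈ level 𝕜 e E K n →
      (seqPart a : NakanoSumPlus 𝕜 e E H) = seqPart b → a = b := fun {a b} ha hb hab =>
    ext (fun m => by simpa using congrArg (coord m) hab) (by rw [ha.1, hb.1])
  -- Level vectors have no Hilbert component, so `seqPart` identifies the levels over `K` and `H`.
  -- Then `T` becomes an injective endomorphism of a finite-dimensional space.
  let f : level 𝕜 e E H n →ₗ[𝕜] level 𝕜 e E H n :=
    (seqPart ∘ₗ T.toLinearMap).restrict fun z hz =>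
      seqPart_mem_level (map_mem_level hp2 hp hE T hz)
  have hf : Function.Injective f := fun a b hab => Subtype.ext <| T.injective <|
    hinj (map_mem_level hp2 hp hE T a.2) (map_mem_level hp2 hp hE T b.2)
      (congrArg Subtype.val hab)
  obtain ⟨z, hz⟩ := LinearMap.injective_iff_surjective.1 hf ⟨seqPart y, seqPart_mem_level hy⟩
  exact ⟨z, z.2, hinj (map_mem_level hp2 hp hE T z.2) hy (congrArg Subtype.val hz)⟩

end Isometry

end NakanoSumPlus

end

end NakanoSums

namespace NakanoSums

noncomputable section

open ModularSpace

/-! ## Ultraroots of modular direct sums -/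

namespace NakanoSumPlus

/-! ### Changing the Hilbert component. -/

section MapSnd

variable {𝕜 : Type v} [RCLike 𝕜] {e : NakanoExponents} {E : ℕ → Type w}
  [∀ n, NormedAddCommGroup (E n)] [∀ n, NormedSpace 𝕜 (E n)]
  {H : Type w} [NormedAddCommGroup H] [NormedSpace 𝕜 H]
  {K : Type w} [NormedAddCommGroup K] [NormedSpace 𝕜 K]

variable (e E) in
/-- The linear isometry of modular direct sums induced by a linear isometry `H → K`. -/
def mapSnd (f : H →ₗᵢ[𝕜] K) : NakanoSumPlus 𝕜 e E H →ₗᵢ[𝕜] NakanoSumPlus 𝕜 e E K where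
  toLinearMap := seqPart + inr ∘ₗ f.toLinearMap ∘ₗ snd
  norm_map' := LinearMap.norm_map_of_norm_eq_one _ fun z hz => by
    rw [← modular_eq_one_iff] at hz ⊢
    rw [← hz, modular_eq, modular_eq]
    simp

@[simp] theorem coord_mapSnd (f : H →ₗᵢ[𝕜] K) (z : NakanoSumPlus 𝕜 e E H) (n : ℕ) :
    coord n (mapSnd e E f z) = coord n z := add_zero _

@[simp] theorem snd_mapSnd (f : H →ₗᵢ[𝕜] K) (z : NakanoSumPlus 𝕜 e E H) :
    snd (mapSnd e E f z) = f (snd z) := zero_add _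

variable (e E) in
/-- The isometry of modular direct sums induced by an isometry `H ≃ K`. -/
def mapSndEquiv (f : H ≃ₗᵢ[𝕜] K) : NakanoSumPlus 𝕜 e E H ≃ₗᵢ[𝕜] NakanoSumPlus 𝕜 e E K :=
  LinearIsometryEquiv.ofSurjective (mapSnd e E f.toLinearIsometry) fun z =>
    ⟨mapSnd e E f.symm.toLinearIsometry z, ext (by simp) (by simp)⟩

theorem continuous_inr : Continuous (inr : H → NakanoSumPlus 𝕜 e E H) :=
  (⟨inr, norm_inr⟩ : H →ₗᵢ[𝕜] NakanoSumPlus 𝕜 e E H).continuous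

/-- A closed subspace containing all `E n` contains the whole Nakano part, hence also the Hilbert
component of each of its elements, and thus splits. -/
theorem range_mapSnd_comap_inr (S : Submodule 𝕜 (NakanoSumPlus 𝕜 e E K))
    (hS : IsClosed (S : Set (NakanoSumPlus 𝕜 e E K))) (h : ∀ n (v : E n), single n v ∈ S) :
    LinearMap.range (mapSnd e E (S.comap inr).subtypeₗᵢ).toLinearMap = S := by
  ext z
  constructor
  · rintro ⟨x, rfl⟩
    refine mem_of_forall_single_mem S hS h _ ?_
    have h1 : snd ((mapSnd e E (S.comap inr).subtypeₗᵢ).toLinearMap x) = (snd x : S.comap inr) :=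
      snd_mapSnd _ x
    rw [h1]
    exact (snd x).2
  · intro hz
    have hseq : seqPart z ∈ S := mem_of_forall_single_mem S hS h _ (by simp)
    have hsnd : inr (snd z) ∈ S := by
      have := S.sub_mem hz hseq
      rwa [sub_eq_of_eq_add' (seqPart_add_inr z).symm] at this
    exact ⟨ofSeq (fun n => coord n z) (summable z) ⟨snd z, hsnd⟩,
      ext (fun n => coord_mapSnd _ _ n) (snd_mapSnd _ _)⟩

end MapSnd

variable {𝕜 : Type v} [RCLike 𝕜] {e : NakanoExponents} {E : ℕ → Type w}
  [∀ n, NormedAddCommGroup (E n)] [∀ n, NormedSpace 𝕜 (E n)] [∀ n, FiniteDimensional 𝕜 (E n)]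
  {K : Type w} [NormedAddCommGroup K] [InnerProductSpace 𝕜 K] [CompleteSpace K]

/-- If an ultrapower of a Banach space `Y` is a modular direct sum, then so is `Y`. -/
theorem exists_equiv_of_ultrapower_equiv (hp2 : ∀ n, e.p n ≠ 2) (hp : Tendsto e.p atTop (𝓝 2))
    (hE : Tendsto (fun n => jordanVonNeumann (E n)) atTop (𝓝 1)) {Y : Type w}
    [NormedAddCommGroup Y] [NormedSpace 𝕜 Y] [CompleteSpace Y] {I : Type w} {U : Ultrafilter I}
    (φ : Ultrapower 𝕜 U Y ≃ₗᵢ[𝕜] NakanoSumPlus 𝕜 e E K) :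
    ∃ (H : Type w) (_ : NormedAddCommGroup H) (_ : InnerProductSpace 𝕜 H) (_ : CompleteSpace H),
      Nonempty (Y ≃ₗᵢ[𝕜] NakanoSumPlus 𝕜 e E H) := by
  set J : Y →ₗᵢ[𝕜] NakanoSumPlus 𝕜 e E K :=
    φ.toLinearIsometry.comp (Ultrapower.diag 𝕜 U Y) with hJ
  obtain ⟨L, _, _, _, ⟨ψ⟩⟩ := exists_ultrapower_equiv (𝕜 := 𝕜) (H := K) hp hE U
  -- Two embeddings into the ultrapower of `E ⊕ₘ K`: the diagonal one, and one whose range consists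
  -- of the classes of families in the range of `J`. Both map each level subspace onto the same
  -- level subspace of `E ⊕ₘ L`.
  set T₁ : NakanoSumPlus 𝕜 e E K →ₗᵢ[𝕜] NakanoSumPlus 𝕜 e E L :=
    ψ.toLinearIsometry.comp (Ultrapower.diag 𝕜 U _)
  set T₂ : NakanoSumPlus 𝕜 e E K →ₗᵢ[𝕜] NakanoSumPlus 𝕜 e E L :=
    ψ.toLinearIsometry.comp ((Ultrapower.map U J).comp φ.symm.toLinearIsometry)
  set S : Submodule 𝕜 (NakanoSumPlus 𝕜 e E K) := LinearMap.range J.toLinearMap with hS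
  have hSc : IsClosed (S : Set (NakanoSumPlus 𝕜 e E K)) := by
    have h := J.isometry.isClosedEmbedding.isClosed_range
    rwa [hS, LinearMap.coe_range]
  have hsingle : ∀ n (v : E n), single n v ∈ S := by
    intro n v
    obtain ⟨x, -, hx⟩ := exists_map_eq_of_mem_level hp2 hp hE T₂
      (map_mem_level hp2 hp hE T₁ (single_mem_level (H := K) n v))
    have hx' : Ultrapower.map U J (φ.symm x) = Ultrapower.diag 𝕜 U _ (single n v) :=
      ψ.injective hx
    obtain ⟨y, hy⟩ := Ultrapower.mk_surjective (φ.symm x)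
    rw [← hy, Ultrapower.map_mk, Ultrapower.diag_apply, Ultrapower.mk_eq_mk_iff] at hx'
    -- The equality of classes says that the vectors `J (y i)` of `S` converge to `single n v` along
    -- `U`.
    refine hSc.mem_of_tendsto (tendsto_iff_norm_sub_tendsto_zero.2 hx')
      (Eventually.of_forall fun i => ⟨y i, rfl⟩)
  have hr := range_mapSnd_comap_inr S hSc hsingle
  have hc : IsClosed ((S.comap inr : Submodule 𝕜 K) : Set K) := hSc.preimage continuous_inr
  exact ⟨S.comap inr, inferInstance, inferInstance, hc.completeSpace_coe,
    ⟨(J.equivRange.trans (LinearIsometryEquiv.ofEq _ _ hr.symm)).trans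
      (mapSnd e E (S.comap inr).subtypeₗᵢ).equivRange.symm⟩⟩

end NakanoSumPlus

end

end NakanoSums

namespace NakanoSums

noncomputable section

open ModularSpace Cardinal

/-! ## Density characters -/

section Density

variable {X : Type w}

theorem densityCharacter_le [TopologicalSpace X] {s : Set X} (hs : Dense s) :
    densityCharacter X ≤ #s :=
  csInf_le' ⟨s, hs, rfl⟩

theorem exists_dense_mk_eq (X : Type w) [TopologicalSpace X] :
    ∃ s : Set X, Dense s ∧ #s = densityCharacter X :=
  csInf_mem (s := {c | ∃ s : Set X, Dense s ∧ #s = c}) ⟨_, univ, dense_univ, rfl⟩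

theorem densityCharacter_le_mk (X : Type w) [TopologicalSpace X] : densityCharacter X ≤ #X :=
  (densityCharacter_le dense_univ).trans (mk_set_le _)

theorem densityCharacter_congr [TopologicalSpace X] {Y : Type w} [TopologicalSpace Y]
    (f : X ≃ₜ Y) : densityCharacter X = densityCharacter Y := by
  have key : ∀ {X Y : Type w} [TopologicalSpace X] [TopologicalSpace Y], X ≃ₜ Y →
      densityCharacter Y ≤ densityCharacter X := fun {X Y} _ _ f => by
    obtain ⟨s, hs, hsc⟩ := exists_dense_mk_eq X
    rw [← hsc]
    exact (densityCharacter_le (f.surjective.denseRange.dense_image f.continuous hs)).trans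
      mk_image_le
  exact le_antisymm (key f.symm) (key f)

theorem mk_le_densityCharacter [PseudoMetricSpace X] {ι : Type w} (v : ι → X) {δ : ℝ} (hδ : 0 < δ)
    (h : ∀ i j, i ≠ j → δ ≤ dist (v i) (v j)) : #ι ≤ densityCharacter X := by
  obtain ⟨s, hs, hsc⟩ := exists_dense_mk_eq X
  rw [← hsc]
  have hex : ∀ i, ∃ x : s, dist (v i) x < δ / 2 := fun i => by
    obtain ⟨x, hx, hxs⟩ := hs.exists_dist_lt (v i) (half_pos hδ)
    exact ⟨⟨x, hx⟩, hxs⟩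
  choose f hf using hex
  refine mk_le_of_injective (f := f) fun i j hij => ?_
  by_contra hne
  have h1 := hf i
  have h2 := hf j
  rw [hij] at h1
  have h3 := dist_triangle_right (v i) (v j) (f j : X)
  linarith [h i j hne]

open scoped Pointwise in
theorem densityCharacter_le_of_dense_span (𝕜 : Type) [RCLike 𝕜] [NormedAddCommGroup X]
    [NormedSpace 𝕜 X] (S : Set X) (hS : (Submodule.span 𝕜 S).topologicalClosure = ⊤) :
    densityCharacter X ≤ max ℵ₀ #S := by
  obtain ⟨Q, hQc, hQd⟩ := TopologicalSpace.exists_countable_dense 𝕜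
  -- Sums of multiples with coefficients in a countable dense set `Q` are already dense. Being
  -- values of finite words in `Q × S`, they are at most `max ℵ₀ #S` many.
  set A : AddSubmonoid X := AddSubmonoid.closure (range fun z : Q × S => (z.1 : 𝕜) • (z.2 : X))
    with hA
  have hcard : #A ≤ max ℵ₀ #S := by
    have h1 : #A ≤ #(FreeAddMonoid (range fun z : Q × S => (z.1 : 𝕜) • (z.2 : X))) := by
      have : (A : Set X) = range (FreeAddMonoid.lift
          ((↑) : (range fun z : Q × S => (z.1 : 𝕜) • (z.2 : X)) → X)) := by
        rw [hA, AddSubmonoid.closure_eq_mrange]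
        rfl
      change #(A : Set X) ≤ _
      rw [this]
      exact mk_range_le
    refine h1.trans ((mk_list_le_max _).trans (max_le (le_max_left _ _) ?_))
    refine mk_range_le.trans ?_
    rw [mk_prod]
    refine (mul_le_max _ _).trans (max_le (max_le ?_ ?_) (le_max_left _ _))
    · exact (lift_le_aleph0.2 (le_aleph0_iff_set_countable.2 hQc)).trans (le_max_left _ _)
    · rw [lift_id']
      exact le_max_right _ _
  have hdense : Dense (A : Set X) := by
    have hsmul : ∀ (c : 𝕜) (x : X), x ∈ S → c • x ∈ A.topologicalClosure := fun c x hx => by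
      have hc : Continuous fun c : 𝕜 => c • x := continuous_id.smul continuous_const
      refine map_mem_closure (f := fun c : 𝕜 => c • x) hc (hQd c) fun q hq => ?_
      exact AddSubmonoid.subset_closure ⟨(⟨q, hq⟩, ⟨x, hx⟩), rfl⟩
    have hspan : (Submodule.span 𝕜 S : Set X) ⊆ closure (A : Set X) := by
      intro x hx
      have hx' : x ∈ (Submodule.span 𝕜 S).toAddSubmonoid := hx
      rw [Submodule.span_eq_closure] at hx'
      have : AddSubmonoid.closure ((univ : Set 𝕜) • S) ≤ A.topologicalClosure := by
        rw [AddSubmonoid.closure_le]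
        rintro _ ⟨c, -, x, hx, rfl⟩
        exact hsmul c x hx
      exact this hx'
    intro x
    have hx : x ∈ (Submodule.span 𝕜 S).topologicalClosure := hS ▸ Submodule.mem_top
    exact closure_minimal hspan isClosed_closure hx
  exact (densityCharacter_le hdense).trans hcard

end Density

namespace NakanoSumPlus

variable {𝕜 : Type} [RCLike 𝕜] {e : NakanoExponents} {E : ℕ → Type w}
  [∀ n, NormedAddCommGroup (E n)] [∀ n, NormedSpace 𝕜 (E n)] [∀ n, FiniteDimensional 𝕜 (E n)]
  {H : Type w} [NormedAddCommGroup H] [InnerProductSpace 𝕜 H]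
  {K : Type w} [NormedAddCommGroup K] [InnerProductSpace 𝕜 K]

omit [∀ n, FiniteDimensional 𝕜 (E n)] in
theorem mk_le_densityCharacter {ι : Type w} (b : HilbertBasis ι 𝕜 H) :
    #ι ≤ densityCharacter (NakanoSumPlus 𝕜 e E H) := by
  refine NakanoSums.mk_le_densityCharacter (fun i => inr (b i)) one_pos fun i j hij => ?_
  rw [dist_eq_norm, ← map_sub, norm_inr]
  have h := norm_sub_sq (𝕜 := 𝕜) (b i) (b j)
  rw [b.orthonormal.2 hij, b.orthonormal.1, b.orthonormal.1] at h
  simp only [map_zero] at h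
  nlinarith [norm_nonneg (b i - b j)]

variable (e E) in
theorem densityCharacter_le {ι : Type w} (b : HilbertBasis ι 𝕜 H) :
    densityCharacter (NakanoSumPlus 𝕜 e E H) ≤ max ℵ₀ #ι := by
  set S₁ : Set (NakanoSumPlus 𝕜 e E H) :=
    ⋃ n, range fun i => single n (Module.finBasis 𝕜 (E n) i) with hS₁
  set S₂ : Set (NakanoSumPlus 𝕜 e E H) := range fun i => inr (b i) with hS₂
  have h1 : #S₁ ≤ ℵ₀ := le_aleph0_iff_set_countable.2
    (countable_iUnion fun n => countable_range _)
  have h2 : #S₂ ≤ #ι := mk_range_le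
  refine (densityCharacter_le_of_dense_span 𝕜 (S₁ ∪ S₂) ?_).trans
    (max_le (le_max_left _ _) ((mk_union_le _ _).trans ((add_le_add h1 h2).trans ?_)))
  · set C := (Submodule.span 𝕜 (S₁ ∪ S₂)).topologicalClosure
    have hsub : S₁ ∪ S₂ ⊆ C := Submodule.subset_span.trans (Submodule.le_topologicalClosure _)
    rw [eq_top_iff]
    rintro z -
    refine mem_of_forall_single_mem C (Submodule.isClosed_topologicalClosure _) (fun n v => ?_) z ?_
    · have h : Submodule.span 𝕜 (range (Module.finBasis 𝕜 (E n))) ≤ C.comap (single n) := by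
        rw [Submodule.span_le]
        rintro _ ⟨i, rfl⟩
        exact hsub (Or.inl (mem_iUnion.2 ⟨n, i, rfl⟩))
      rw [Module.Basis.span_eq] at h
      exact h Submodule.mem_top
    · have hcl : IsClosed ((C.comap inr : Submodule 𝕜 H) : Set H) :=
        (Submodule.isClosed_topologicalClosure _).preimage continuous_inr
      have h : (Submodule.span 𝕜 (range b)).topologicalClosure ≤ C.comap inr := by
        refine Submodule.topologicalClosure_minimal _ ?_ hcl
        rw [Submodule.span_le]
        rintro _ ⟨i, rfl⟩
        exact hsub (Or.inr ⟨i, rfl⟩)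
      rw [b.dense_span] at h
      exact h Submodule.mem_top
  · exact add_le_max _ _ |>.trans (by simp)

/-- The separable Nakano part contributes at most `ℵ₀`, which an uncountable `κ` absorbs. -/
theorem mk_eq_of_densityCharacter_eq {ι : Type w} (b : HilbertBasis ι 𝕜 H) {κ : Cardinal.{w}}
    (hκ : ℵ₀ < κ) (h : densityCharacter (NakanoSumPlus 𝕜 e E H) = κ) : #ι = κ := by
  have h1 := densityCharacter_le e E b
  rw [h, le_max_iff] at h1
  exact le_antisymm (h ▸ mk_le_densityCharacter b) (h1.resolve_left (not_le.2 hκ))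

/-- Modular direct sums are determined by their density character if it is uncountable. -/
theorem nonempty_equiv_of_densityCharacter_eq [CompleteSpace H] [CompleteSpace K]
    {κ : Cardinal.{w}} (hκ : ℵ₀ < κ) (hH : densityCharacter (NakanoSumPlus 𝕜 e E H) = κ)
    (hK : densityCharacter (NakanoSumPlus 𝕜 e E K) = κ) :
    Nonempty (NakanoSumPlus 𝕜 e E H ≃ₗᵢ[𝕜] NakanoSumPlus 𝕜 e E K) := by
  obtain ⟨s, b, -⟩ := exists_hilbertBasis 𝕜 H
  obtain ⟨t, c, -⟩ := exists_hilbertBasis 𝕜 K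
  have hst : #s = #t :=
    (mk_eq_of_densityCharacter_eq b hκ hH).trans (mk_eq_of_densityCharacter_eq c hκ hK).symm
  obtain ⟨f⟩ := Cardinal.eq.1 hst
  let c' : HilbertBasis s 𝕜 K := HilbertBasis.mk (v := c ∘ f)
    (c.orthonormal.comp f f.injective) (by rw [f.surjective.range_comp, c.dense_span])
  exact ⟨mapSndEquiv e E (b.repr.trans c'.repr.symm)⟩

/-- The Hilbert space `ℓ²(κ)`. -/
theorem exists_hilbert_densityCharacter_eq (𝕜 : Type) [RCLike 𝕜] [∀ n, NormedSpace 𝕜 (E n)]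
    [∀ n, FiniteDimensional 𝕜 (E n)] {κ : Cardinal.{w}} (hκ : ℵ₀ < κ) :
    ∃ (H : Type w) (_ : NormedAddCommGroup H) (_ : InnerProductSpace 𝕜 H) (_ : CompleteSpace H),
      densityCharacter (NakanoSumPlus 𝕜 e E H) = κ := by
  refine ⟨lp (fun _ : κ.out => 𝕜) 2, inferInstance, inferInstance, inferInstance, ?_⟩
  let b : HilbertBasis κ.out 𝕜 (lp (fun _ : κ.out => 𝕜) 2) := ⟨LinearIsometryEquiv.refl 𝕜 _⟩
  refine le_antisymm ((densityCharacter_le e E b).trans ?_) ?_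
  · rw [mk_out]
    exact max_le hκ.le le_rfl
  · simpa using mk_le_densityCharacter (e := e) (E := E) b

/-! ## Ultrapowers of large density -/

-- The upper bound counts families: `#S ^ #S = 2 ^ #S`. For the lower bound, each `A ⊆ S` is coded
-- at a finite set `i` by a unit vector in a coordinate determined by `A ∩ i`. If `s` distinguishes
-- `A` from `B`, the two codes lie in different coordinates for every `i` containing `s`, so the
-- classes are at distance at least one.
omit [∀ n, FiniteDimensional 𝕜 (E n)] in
theorem densityCharacter_ultrapower (hE : Tendsto (fun n => jordanVonNeumann (E n)) atTop (𝓝 1))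
    {S : Type w} [Infinite S] (hS : #(NakanoSumPlus 𝕜 e E H) ≤ #S) {U : Ultrafilter (Finset S)}
    (hU : ∀ s, ∀ᶠ i in (U : Filter (Finset S)), s ∈ i) :
    densityCharacter (Ultrapower 𝕜 U (NakanoSumPlus 𝕜 e E H)) = 2 ^ #S := by
  refine le_antisymm ?_ ?_
  · refine (densityCharacter_le_mk _).trans ((mk_le_of_surjective Ultrapower.mk_surjective).trans ?_)
    have h : #(lp (fun _ : Finset S => NakanoSumPlus 𝕜 e E H) ∞)
        ≤ #(Finset S → NakanoSumPlus 𝕜 e E H) :=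
      mk_le_of_injective (f := fun x i => x i) fun x y hxy => lp.ext hxy
    refine h.trans ?_
    rw [← power_def, mk_finset_of_infinite, ← power_self_eq (aleph0_le_mk S)]
    exact power_le_power_right hS
  · obtain ⟨N, hN⟩ := eventually_atTop.1 (eventually_exists_norm_eq_one (E := E) 𝕜 hE)
    choose u hu using fun n => hN (N + n) (Nat.le_add_right N n)
    have hinj : ∀ i : Finset S, ∃ f : Set i → ℕ, Function.Injective f := fun i =>
      exists_injective_nat _
    choose f hf using hinj
    let m : Set S → Finset S → ℕ := fun A i => f i {x | (x : S) ∈ A}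
    let w : Set S → Finset S → NakanoSumPlus 𝕜 e E H := fun A i =>
      single (N + m A i) (u (m A i))
    let v : Set S → lp (fun _ : Finset S => NakanoSumPlus 𝕜 e E H) ∞ := fun A =>
      Ultrapower.ofBounded (w A) 1 fun i => by rw [norm_single, hu]
    rw [← mk_set]
    refine NakanoSums.mk_le_densityCharacter (fun A => Ultrapower.mk 𝕜 U (v A)) one_pos
      fun A B hAB => ?_
    have hsub : Ultrapower.mk 𝕜 U (v A) - Ultrapower.mk 𝕜 U (v B) = Ultrapower.mk 𝕜 U (v A - v B) :=
      (LinearMap.map_sub _ _ _).symm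
    rw [dist_eq_norm, hsub]
    have hlim := Ultrapower.tendsto_norm_mk (𝕜 := 𝕜) (U := U) (v A - v B)
    refine ge_of_tendsto hlim ?_
    obtain ⟨s, hs⟩ : ∃ s, ¬(s ∈ A ↔ s ∈ B) := by
      by_contra! h
      exact hAB (Set.ext h)
    filter_upwards [hU s] with i hi
    have hm : N + m A i ≠ N + m B i := fun h => hs <| by
      have := hf i (Nat.add_left_cancel h)
      exact Set.ext_iff.1 this ⟨s, hi⟩
    have hle := norm_coord_le (w A i - w B i) (N + m A i)
    rw [map_sub, coord_single_same, coord_single_of_ne hm, sub_zero, hu] at hle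
    exact hle

/-- Any two modular direct sums have isometric ultrapowers. -/
theorem exists_ultrapower_equiv_ultrapower [CompleteSpace H] [CompleteSpace K]
    (hp : Tendsto e.p atTop (𝓝 2)) (hE : Tendsto (fun n => jordanVonNeumann (E n)) atTop (𝓝 1)) :
    ∃ (I : Type w) (U : Ultrafilter I), Nonempty
      (Ultrapower 𝕜 U (NakanoSumPlus 𝕜 e E H) ≃ₗᵢ[𝕜] Ultrapower 𝕜 U (NakanoSumPlus 𝕜 e E K)) := by
  -- One infinite index set, large enough for both spaces, so that both ultrapowers have density
  -- character `2 ^ #S`.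
  let S : Type w := (NakanoSumPlus 𝕜 e E H × NakanoSumPlus 𝕜 e E K) × ULift.{w} ℕ
  let U : Ultrafilter (Finset S) := Ultrafilter.of atTop
  have hU : ∀ s, ∀ᶠ i in (U : Filter (Finset S)), s ∈ i := fun s =>
    (Ultrafilter.of_le atTop) <| (eventually_ge_atTop {s}).mono fun i hi =>
      hi (Finset.mem_singleton_self s)
  have hH : #(NakanoSumPlus 𝕜 e E H) ≤ #S :=
    mk_le_of_injective (f := fun x => ((x, 0), ⟨0⟩)) fun x y h => congrArg (fun z => z.1.1) h
  have hK : #(NakanoSumPlus 𝕜 e E K) ≤ #S :=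
    mk_le_of_injective (f := fun x => ((0, x), ⟨0⟩)) fun x y h => congrArg (fun z => z.1.2) h
  have hκ : ℵ₀ < 2 ^ #S := (aleph0_le_mk S).trans_lt (cantor _)
  obtain ⟨L, _, _, _, ⟨φ⟩⟩ := exists_ultrapower_equiv (𝕜 := 𝕜) (H := H) hp hE U
  obtain ⟨M, _, _, _, ⟨ψ⟩⟩ := exists_ultrapower_equiv (𝕜 := 𝕜) (H := K) hp hE U
  obtain ⟨θ⟩ := nonempty_equiv_of_densityCharacter_eq hκ
    ((densityCharacter_congr φ.toHomeomorph).symm.trans (densityCharacter_ultrapower hE hH hU))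
    ((densityCharacter_congr ψ.toHomeomorph).symm.trans (densityCharacter_ultrapower hE hK hU))
  exact ⟨_, U, ⟨(φ.trans θ).trans ψ.symm⟩⟩

omit [∀ n, FiniteDimensional 𝕜 (E n)] in
/-- A Nakano direct sum is a modular direct sum with the zero Hilbert space. -/
theorem nonempty_nakanoSum_equiv [Subsingleton H] :
    Nonempty (NakanoSum 𝕜 e E ≃ₗᵢ[𝕜] NakanoSumPlus 𝕜 e E H) := by
  let f : NakanoSum 𝕜 e E →ₗ[𝕜] NakanoSumPlus 𝕜 e E H :=
    (equivProd 𝕜 e E H).symm.toLinearMap ∘ₗ LinearMap.inl 𝕜 (nakanoSubmodule 𝕜 e E) H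
  have hf : ∀ x, ‖f x‖ = ‖x‖ := fun x => by
    rw [ModularSpace.norm_eq, ModularSpace.norm_eq]
    congr 1
    ext t
    have : ((nakanoModular 𝕜 e E).directSum (sqModular 𝕜 H)).toFun (((t⁻¹ : ℝ) : 𝕜) • f x)
        = (nakanoModular 𝕜 e E).toFun (((t⁻¹ : ℝ) : 𝕜) • x) + ‖((t⁻¹ : ℝ) : 𝕜) • (0 : H)‖ ^ 2 := rfl
    rw [smul_zero, norm_zero, zero_pow two_ne_zero, add_zero] at this
    exact and_congr_right fun _ => iff_of_eq (congrArg (· ≤ (1 : ℝ)) this)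
  exact ⟨LinearIsometryEquiv.ofSurjective ⟨f, hf⟩ fun z =>
    ⟨((equivProd 𝕜 e E H) z).1, Prod.ext rfl (Subsingleton.elim _ _)⟩⟩

end NakanoSumPlus

/-! ## The elementary class of a Nakano direct sum -/

section ElementaryClass

open NakanoSumPlus

variable {𝕜 : Type} [RCLike 𝕜] {e : NakanoExponents} {E : ℕ → Type w}
  [∀ n, NormedAddCommGroup (E n)] [∀ n, NormedSpace 𝕜 (E n)] [∀ n, FiniteDimensional 𝕜 (E n)]

theorem elementaryClass_eq (hp2 : ∀ n, e.p n ≠ 2) (hp : Tendsto e.p atTop (𝓝 2))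
    (hE : Tendsto (fun n => jordanVonNeumann (E n)) atTop (𝓝 1)) :
    elementaryClass 𝕜 (NakanoSum 𝕜 e E) = modularSumClass 𝕜 e E := by
  -- The `ℓ²` space over the empty index type serves as the zero Hilbert space.
  obtain ⟨ν⟩ := nonempty_nakanoSum_equiv (𝕜 := 𝕜) (e := e) (E := E)
    (H := lp (fun _ : PEmpty.{w + 1} => 𝕜) 2)
  ext Y
  constructor
  · rintro ⟨I, J, U, V, ⟨φ⟩⟩
    obtain ⟨K, _, _, _, ⟨ψ⟩⟩ := exists_ultrapower_equiv (𝕜 := 𝕜)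
      (H := lp (fun _ : PEmpty.{w + 1} => 𝕜) 2) hp hE V
    exact exists_equiv_of_ultrapower_equiv hp2 hp hE
      ((φ.trans (Ultrapower.mapEquiv V ν)).trans ψ)
  · rintro ⟨H, _, _, _, ⟨φ⟩⟩
    obtain ⟨I, U, ⟨ψ⟩⟩ := exists_ultrapower_equiv_ultrapower (𝕜 := 𝕜) (E := E) (H := H)
      (K := lp (fun _ : PEmpty.{w + 1} => 𝕜) 2) hp hE
    exact ⟨I, I, U, U, ⟨((Ultrapower.mapEquiv U φ).trans ψ).trans (Ultrapower.mapEquiv U ν).symm⟩⟩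

theorem closedUnderUltrapowers_modularSumClass (hp : Tendsto e.p atTop (𝓝 2))
    (hE : Tendsto (fun n => jordanVonNeumann (E n)) atTop (𝓝 1)) :
    ClosedUnderUltrapowers 𝕜 (modularSumClass 𝕜 e E) := by
  rintro X ⟨H, _, _, _, ⟨φ⟩⟩ I U Y ⟨ψ⟩
  obtain ⟨K, hK, hK', hK'', ⟨θ⟩⟩ := exists_ultrapower_equiv (𝕜 := 𝕜) (H := H) hp hE U
  exact ⟨K, hK, hK', hK'', ⟨(ψ.symm.trans (Ultrapower.mapEquiv U φ)).trans θ⟩⟩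

theorem closedUnderUltraroots_modularSumClass (hp2 : ∀ n, e.p n ≠ 2)
    (hp : Tendsto e.p atTop (𝓝 2))
    (hE : Tendsto (fun n => jordanVonNeumann (E n)) atTop (𝓝 1)) :
    ClosedUnderUltraroots 𝕜 (modularSumClass 𝕜 e E) := by
  rintro X ⟨H, _, _, _, ⟨φ⟩⟩ I U Y ⟨ψ⟩
  exact exists_equiv_of_ultrapower_equiv hp2 hp hE (ψ.trans φ)

theorem categoricalIn_modularSumClass {κ : Cardinal.{w}} (hκ : ℵ₀ < κ) :
    CategoricalIn 𝕜 κ (modularSumClass 𝕜 e E) := by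
  obtain ⟨H, hH, hH', hH'', hκH⟩ := exists_hilbert_densityCharacter_eq (e := e) (E := E) 𝕜 hκ
  have : ∀ n, CompleteSpace (E n) := fun n => FiniteDimensional.complete 𝕜 (E n)
  refine ⟨⟨NakanoSumPlus 𝕜 e E H⟩, ⟨H, hH, hH', hH'', ⟨LinearIsometryEquiv.refl 𝕜 _⟩⟩, hκH, ?_⟩
  rintro Y ⟨K, _, _, _, ⟨φ⟩⟩ hY
  obtain ⟨θ⟩ := nonempty_equiv_of_densityCharacter_eq hκ
    ((densityCharacter_congr φ.toHomeomorph).symm.trans hY) hκH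
  exact ⟨φ.trans θ⟩

end ElementaryClass

end

end NakanoSums

theorem corollary4p5 {𝕜 : Type} [RCLike 𝕜] (e : NakanoSums.NakanoExponents)
    (hp2 : ∀ n, e.p n ≠ 2) (hp : Filter.Tendsto e.p Filter.atTop (nhds 2))
    (E : ℕ → Type u) [∀ n, NormedAddCommGroup (E n)] [∀ n, NormedSpace 𝕜 (E n)]
    [∀ n, FiniteDimensional 𝕜 (E n)]
    (hE : Filter.Tendsto (fun n => NakanoSums.jordanVonNeumann (E n)) Filter.atTop (nhds 1)) :
    NakanoSums.elementaryClass 𝕜 (NakanoSums.NakanoSum 𝕜 e E)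
        = NakanoSums.modularSumClass 𝕜 e E ∧
      NakanoSums.UncountablyCategorical 𝕜
        (NakanoSums.elementaryClass 𝕜 (NakanoSums.NakanoSum 𝕜 e E)) ∧
      ∀ κ : Cardinal.{u}, Cardinal.aleph0 < κ →
        NakanoSums.CategoricalIn 𝕜 κ
          (NakanoSums.elementaryClass 𝕜 (NakanoSums.NakanoSum 𝕜 e E)) := by
  rw [NakanoSums.elementaryClass_eq hp2 hp hE]
  exact ⟨rfl, ⟨NakanoSums.closedUnderUltrapowers_modularSumClass hp hE,
    NakanoSums.closedUnderUltraroots_modularSumClass hp2 hp hE,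
    2 ^ Cardinal.aleph0, Cardinal.cantor _,
    NakanoSums.categoricalIn_modularSumClass (Cardinal.cantor _)⟩,
    fun _ hκ => NakanoSums.categoricalIn_modularSumClass hκ⟩
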